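/- Let $d\ge 1$ and let $\mathcal U$ be a Poisson point process on $(0,\infty)\times\mathbb Z^d$ whose intensity is Lebesgue measure in time over each site (independent rate-one Poisson clocks at the sites of $\mathbb Z^d$). The dual RSOS process driven by $\mathcal U$ is the height function $f:[0,\infty)\times\mathbb Z^d\to\mathbb Z$ with $f(0,x)=\|x\|_1$ such that $f(\cdot,x)$ is constant between consecutive clock rings at $x$, and at a ring $(t,x)\in\mathcal U$ $$f(t,x)=\begin{cases} f(t^-,x)+1 & \text{if } |f(t^-,x)+1-f(t^-,x\pm e_i)|\le 1 \text{ for all } i=1,\dots,d \text{ and both signs},\\ f(t^-,x) & \text{otherwise.}\end{cases}$$ Put $$M_t=\inf_{x\in\mathbb Z^d} f(t,x),\qquad T(u)=\inf\{t\ge 0: M_t\ge u\}\quad(u\in\mathbb N).$$ Then there is a deterministic constant $\rho$, depending only on $d$, with $0<\rho<\infty$, such that almost surely the dual RSOS process exists and is unique, $T(u)<\infty$ for all $u\in\mathbb N$, and $$\lim_{u\to\infty}\frac{T(u)}{u}=\rho,\qquad \lim_{t\to\infty}\frac{M_t}{t}=\rho^{-1}.$$ -/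

import Mathlib

open Filter Topology MeasureTheory ProbabilityTheory

/-- The sites of the lattice `ℤ^d`. -/
abbrev Site (d : ℕ) : Type := Fin d → ℤ

/-- The `ℓ¹` norm on `ℤ^d`. -/
def l1Norm {d : ℕ} (x : Site d) : ℤ := ∑ i, |x i|

/-- A random set `U` is (the support of) a Poisson point process with intensity measure `Λ`:
the number of points in a measurable set of finite intensity is Poisson distributed, and the
numbers of points in disjoint measurable sets are independent. (Used for a diffuse `Λ`, where
the process has no multiple points and is thus described by its set of points.) -/
structure IsPoissonPointProcess {Ω X : Type*} [MeasurableSpace Ω] [MeasurableSpace X]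
    (U : Ω → Set X) (Λ : Measure X) (P : Measure Ω) : Prop where
  measurable_count : ∀ B : Set X, MeasurableSet B → Measurable fun ω => (U ω ∩ B).encard
  law_count : ∀ (B : Set X) (r : NNReal), MeasurableSet B → Λ B = (r : ENNReal) →
    P.map (fun ω => (U ω ∩ B).encard) = (poissonMeasure r).map (fun k : ℕ => (k : ℕ∞))
  indep_count : ∀ (n : ℕ) (B : Fin n → Set X), (∀ i, MeasurableSet (B i)) →
    Pairwise (fun i j => Disjoint (B i) (B j)) →
    iIndepFun (fun i ω => (U ω ∩ B i).encard) P

/-- The intensity of the clock rings on `(0, ∞) × ℤ^d`: Lebesgue measure in time over each site,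
so that the clocks of distinct sites are independent Poisson processes of rate one. -/
noncomputable def clockIntensity (d : ℕ) : Measure (ℝ × Site d) :=
  (volume.restrict (Set.Ioi (0 : ℝ))).prod Measure.count

/-- The new height at `x` when the clock of `x` rings and the heights are `h`: a block is added
if afterwards the height at `x` differs by at most one from the heights at all the nearest
neighbours `x ± e_i`; otherwise the height is unchanged. -/
def rsosUpdate {d : ℕ} (h : Site d → ℤ) (x : Site d) : ℤ :=
  if ∀ i : Fin d, |h x + 1 - h (x + Pi.single i 1)| ≤ 1 ∧ |h x + 1 - h (x - Pi.single i 1)| ≤ 1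
  then h x + 1 else h x

/-- `f t x` (for times `t ≥ 0`) is an RSOS surface driven by the clock rings `U` with initial
configuration `H`. The left limit of the heights at a ring time `t` is expressed by evaluating
them at all times `s < t` close enough to `t`. -/
structure IsRSOS {d : ℕ} (U : Set (ℝ × Site d)) (H : Site d → ℤ) (f : ℝ → Site d → ℤ) :
    Prop where
  initial : ∀ x, f 0 x = H x
  const_between_rings : ∀ (x : Site d) (s t : ℝ), 0 ≤ s → s ≤ t →
    (∀ r ∈ Set.Ioc s t, (r, x) ∉ U) → f t x = f s x
  update_at_ring : ∀ (x : Site d) (t : ℝ), 0 < t → (t, x) ∈ U →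
    ∀ᶠ s in 𝓝[<] t, f t x = rsosUpdate (f s) x

/-- A dual RSOS surface: the RSOS dynamics started from the well `‖x‖₁`. -/
def IsDualRSOS {d : ℕ} (U : Set (ℝ × Site d)) (f : ℝ → Site d → ℤ) : Prop :=
  IsRSOS U l1Norm f

/-- The minimum height `M_t` of a surface. -/
noncomputable def minHeight {d : ℕ} (f : ℝ → Site d → ℤ) (t : ℝ) : ℤ := ⨅ x, f t x

/-- The nonnegative times at which the minimum height is at least `u`. -/
def hittingSet {d : ℕ} (f : ℝ → Site d → ℤ) (u : ℕ) : Set ℝ :=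
  {t | 0 ≤ t ∧ (u : ℤ) ≤ minHeight f t}

/-- The hitting time `T(u) = inf {t ≥ 0 : M_t ≥ u}`. -/
noncomputable def hitTime {d : ℕ} (f : ℝ → Site d → ℤ) (u : ℕ) : ℝ := sInf (hittingSet f u)

/-! Cut time into slots of length `2 ^ (-m)` and update at once all the sites whose clocks ring in a
slot. This is a discrete dynamics with i.i.d. marks; its updates keep slopes at most one and are
monotone in the surface.

Subadditivity: at time `n` the surface, having slopes at most one, lies below a copy of the well
raised to the minimum and centred at a minimiser. By monotonicity the minimum at time `n + k` is at
most the minimum at time `n` plus the minimum at time `k` of a well driven by the later marks seen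
from the minimiser (`minWell_splice_le`). The minimiser is a function of the past, so those marks
are independent of the past and have the original law (`map_splice`). Hence the means are
subadditive, and E M_{2n}² ≤ 2 E M_n² + 2 (E M_n)².

Positive speed: for small `θ`, the sum over sites of `θ` to the height is carried for at least one
half by local minima, so it decays exponentially in mean. Jensen's inequality then bounds the mean
minimum below linearly, uniformly in the mesh (`exists_linear_lower_bound`).

Continuous time: in a short slot the ringing sites form a subcritical percolation, so no ring
depends on an infinite chain of earlier rings (`ae_nice`). The surface is then built by well-founded
recursion. Every solution agrees at a given site and integer time with all fine enough
discretisations, and uniqueness follows from the same comparison at ring times. Moments pass to the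
limit, dominated through the number of rings at the origin.

Almost sure limit: the second moment inequality makes the variances of M_{2^k n} / (2^k n) summable
in `k`, so these ratios converge to the speed (`ae_tendsto_of_doubling`). Monotonicity in time fills
the gaps (`tendsto_div_of_monotoneOn`), and inverting a linearly growing function gives the hitting
times (`tendsto_hitTime_div`). -/

namespace DualRSOS

/-! ### Local update rule: slopes, monotonicity, symmetries. -/

/-- The nearest neighbour of `x` in the direction `e`. -/
def nbr {d : ℕ} (x : Site d) (e : Fin d × Bool) : Site d :=
  if e.2 then x + Pi.single e.1 1 else x - Pi.single e.1 1

lemma nbr_nbr {d : ℕ} (x : Site d) (e : Fin d × Bool) : nbr (nbr x e) (e.1, !e.2) = x := by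
  obtain ⟨i, b⟩ := e
  cases b <;> simp [nbr]

lemma nbr_add {d : ℕ} (x y : Site d) (e : Fin d × Bool) : nbr (x + y) e = nbr x e + y := by
  unfold nbr
  split_ifs <;> abel

lemma forall_nbr_iff {d : ℕ} (x : Site d) (p : Site d → Prop) :
    (∀ e, p (nbr x e)) ↔ ∀ i : Fin d, p (x + Pi.single i 1) ∧ p (x - Pi.single i 1) := by
  simp [nbr, Prod.forall, Bool.forall_bool, and_comm]

lemma rsosUpdate_eq {d : ℕ} (h : Site d → ℤ) (x : Site d) :
    rsosUpdate h x = if ∀ e, |h x + 1 - h (nbr x e)| ≤ 1 then h x + 1 else h x := by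
  unfold rsosUpdate
  simp only [forall_nbr_iff x (fun y => |h x + 1 - h y| ≤ 1)]

lemma rsosUpdate_congr {d : ℕ} {h h' : Site d → ℤ} {x : Site d} (hx : h x = h' x)
    (hn : ∀ e, h (nbr x e) = h' (nbr x e)) : rsosUpdate h x = rsosUpdate h' x := by
  simp only [rsosUpdate_eq, hx, hn]

lemma le_rsosUpdate {d : ℕ} (h : Site d → ℤ) (x : Site d) : h x ≤ rsosUpdate h x := by
  unfold rsosUpdate; split_ifs <;> omega

lemma rsosUpdate_le {d : ℕ} (h : Site d → ℤ) (x : Site d) : rsosUpdate h x ≤ h x + 1 := by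
  unfold rsosUpdate; split_ifs <;> omega

/-- Heights of neighbouring sites differ by at most one. -/
def Lip {d : ℕ} (h : Site d → ℤ) : Prop := ∀ x e, |h (nbr x e) - h x| ≤ 1

/-- When slopes are at most one, only a strictly lower neighbour can block a block, so the sites
that may grow are exactly the local minima. -/
lemma Lip.rsosUpdate_eq {d : ℕ} {h : Site d → ℤ} (hh : Lip h) (x : Site d) :
    rsosUpdate h x = if ∀ e, h x ≤ h (nbr x e) then h x + 1 else h x := by
  rw [DualRSOS.rsosUpdate_eq]
  congr 1
  refine propext (forall_congr' fun e => ?_)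
  have := hh x e
  rw [abs_le] at *
  constructor <;> intro <;> omega

/-- Simultaneous update of all the sites marked by `b`. -/
def step {d : ℕ} (b : Site d → Bool) (h : Site d → ℤ) : Site d → ℤ :=
  fun x => if b x then rsosUpdate h x else h x

lemma le_step {d : ℕ} (b : Site d → Bool) (h : Site d → ℤ) (x : Site d) : h x ≤ step b h x := by
  unfold step; split_ifs
  exacts [le_rsosUpdate h x, le_rfl]

lemma Lip.step_eq {d : ℕ} {h : Site d → ℤ} (hh : Lip h) (b : Site d → Bool) (x : Site d) :
    step b h x = if b x ∧ ∀ e, h x ≤ h (nbr x e) then h x + 1 else h x := by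
  unfold step
  rw [hh.rsosUpdate_eq, ite_and]

/-- A site that rises was not above its neighbours, so it ends at most one above any of them;
neighbours rising together keep their difference. Parallel updating is therefore harmless. -/
lemma Lip.step {d : ℕ} {h : Site d → ℤ} (hh : Lip h) (b : Site d → Bool) : Lip (step b h) := by
  intro x e
  have hxe := hh x e
  rw [hh.step_eq, hh.step_eq]
  rw [abs_le] at *
  split_ifs with h1 h2 h2
  · omega
  · have := h1.2 (e.1, !e.2)
    rw [nbr_nbr] at this
    constructor <;> omega
  · have := h2.2 e
    constructor <;> omega
  · omega

/-- Attractiveness: order could fail only where the two heights coincide, and there a local minimum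
of the lower surface is also one of the upper surface. -/
lemma step_mono {d : ℕ} {h h' : Site d → ℤ} (hh : Lip h) (hh' : Lip h') (hle : ∀ x, h x ≤ h' x)
    (b : Site d → Bool) (x : Site d) : DualRSOS.step b h x ≤ DualRSOS.step b h' x := by
  rw [hh.step_eq, hh'.step_eq]
  have hx := hle x
  split_ifs with h1 h2 h2
  · omega
  · by_contra hcon
    have hxx : h x = h' x := by omega
    exact h2 ⟨h1.1, fun e => by have := h1.2 e; have := hle (nbr x e); omega⟩
  · omega
  · exact hx

lemma step_add_const {d : ℕ} (b : Site d → Bool) (h : Site d → ℤ) (c : ℤ) (x : Site d) :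
    DualRSOS.step b (fun y => h y + c) x = DualRSOS.step b h x + c := by
  unfold DualRSOS.step rsosUpdate
  have : ∀ a b : ℤ, a + c + 1 - (b + c) = a + 1 - b := by intros; ring
  simp only [this]
  split_ifs <;> ring

lemma step_translate {d : ℕ} (b : Site d → Bool) (h : Site d → ℤ) (y x : Site d) :
    DualRSOS.step b h (x + y) = DualRSOS.step (fun z => b (z + y)) (fun z => h (z + y)) x := by
  unfold DualRSOS.step
  simp only [rsosUpdate_eq, nbr_add]

/-! ### Discrete time dynamics. -/

/-- The field of marks that drives the discrete time dynamics. -/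
abbrev Marks (d : ℕ) : Type := ℕ × Site d → Bool

/-- The discrete time dynamics: at step `j` the sites `x` with `β (j, x)` are updated. -/
def evol {d : ℕ} (β : Marks d) (H : Site d → ℤ) : ℕ → Site d → ℤ
  | 0 => H
  | n + 1 => DualRSOS.step (fun x => β (n, x)) (evol β H n)

lemma Lip.evol {d : ℕ} {H : Site d → ℤ} (hH : Lip H) (β : Marks d) (n : ℕ) :
    Lip (evol β H n) := by
  induction n with
  | zero => exact hH
  | succ n ih => exact ih.step _

lemma evol_add {d : ℕ} (β : Marks d) (H : Site d → ℤ) (n k : ℕ) :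
    evol β H (n + k) = evol (fun p => β (p.1 + n, p.2)) (evol β H n) k := by
  induction k with
  | zero => rfl
  | succ k ih =>
    rw [← add_assoc]
    simp only [evol, ih, add_comm]

lemma evol_congr {d : ℕ} {β β' : Marks d} (H : Site d → ℤ) (n : ℕ)
    (h : ∀ p : ℕ × Site d, p.1 < n → β p = β' p) : evol β H n = evol β' H n := by
  induction n with
  | zero => rfl
  | succ n ih =>
    simp only [evol]
    rw [ih fun p hp => h p (by omega)]
    congr 1
    ext x
    rw [h (n, x) (by simp)]

lemma evol_mono_time {d : ℕ} (β : Marks d) (H : Site d → ℤ) (x : Site d) :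
    Monotone fun n => evol β H n x :=
  monotone_nat_of_le_succ fun n => le_step _ (evol β H n) x

lemma le_evol {d : ℕ} (β : Marks d) (H : Site d → ℤ) (n : ℕ) (x : Site d) : H x ≤ evol β H n x :=
  evol_mono_time β H x (Nat.zero_le n)

lemma evol_mono {d : ℕ} {H H' : Site d → ℤ} (hH : Lip H) (hH' : Lip H') (hle : ∀ x, H x ≤ H' x)
    (β : Marks d) (n : ℕ) (x : Site d) : evol β H n x ≤ evol β H' n x := by
  induction n generalizing x with
  | zero => exact hle x
  | succ n ih => exact step_mono (hH.evol β n) (hH'.evol β n) ih _ x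

lemma evol_add_const {d : ℕ} (β : Marks d) (H : Site d → ℤ) (c : ℤ) (n : ℕ) (x : Site d) :
    evol β (fun y => H y + c) n x = evol β H n x + c := by
  induction n generalizing x with
  | zero => rfl
  | succ n ih =>
    simp only [evol]
    rw [← step_add_const, funext ih]

lemma evol_translate {d : ℕ} (β : Marks d) (H : Site d → ℤ) (y : Site d) (n : ℕ) (x : Site d) :
    evol β H n (x + y) = evol (fun p => β (p.1, p.2 + y)) (fun z => H (z + y)) n x := by
  induction n generalizing x with
  | zero => rfl
  | succ n ih =>
    simp only [evol]
    rw [step_translate, funext ih]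

/-! ### The well as the largest surface of slope at most one with given value at its centre. -/

lemma l1Norm_nonneg {d : ℕ} (x : Site d) : 0 ≤ l1Norm x :=
  Finset.sum_nonneg fun _ _ => abs_nonneg _

@[simp] lemma l1Norm_zero {d : ℕ} : l1Norm (0 : Site d) = 0 := by simp [l1Norm]

lemma l1Norm_nbr_sub {d : ℕ} (x : Site d) (e : Fin d × Bool) :
    ∃ c : ℤ, |c| = 1 ∧ nbr x e = fun j => x j + if j = e.1 then c else 0 := by
  obtain ⟨i, b⟩ := e
  cases b
  · exact ⟨-1, by simp, by ext j; by_cases h : j = i <;> simp [nbr, h]; ring⟩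
  · exact ⟨1, by simp, by ext j; by_cases h : j = i <;> simp [nbr, h]⟩

lemma lip_l1Norm {d : ℕ} : Lip (l1Norm (d := d)) := by
  intro x e
  obtain ⟨c, hc, hx⟩ := l1Norm_nbr_sub x e
  rw [hx]
  unfold l1Norm
  rw [← Finset.sum_sub_distrib]
  refine (Finset.abs_sum_le_sum_abs _ _).trans ?_
  calc ∑ i, |(|x i + if i = e.1 then c else 0| - |x i|)|
      ≤ ∑ i, if i = e.1 then 1 else 0 := by
        refine Finset.sum_le_sum fun i _ => ?_
        split_ifs with h
        · refine (abs_abs_sub_abs_le _ _).trans ?_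
          simp [hc]
        · simp
    _ = 1 := by simp

lemma le_add_l1Norm {d : ℕ} (n : ℕ) : ∀ {h : Site d → ℤ}, Lip h → ∀ x z : Site d,
    l1Norm z ≤ n → h (z + x) ≤ h x + l1Norm z := by
  induction n with
  | zero =>
    intro h _ x z hz
    have : z = 0 := by
      funext i
      have h0 : l1Norm z = 0 := le_antisymm (by simpa using hz) (l1Norm_nonneg z)
      have := (Finset.sum_eq_zero_iff_of_nonneg (fun i _ => abs_nonneg (z i))).1 h0 i
        (Finset.mem_univ _)
      simpa using this
    simp [this]
  | succ n ih =>
    intro h hh x z hz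
    by_cases h0 : z = 0
    · simp [h0]
    obtain ⟨i, hi⟩ : ∃ i, z i ≠ 0 := by
      by_contra hcon
      push Not at hcon
      exact h0 (funext hcon)
    -- A step towards the origin along a nonzero coordinate lowers the norm by one and changes the
    -- height by at most one.
    obtain ⟨e, he⟩ : ∃ e : Fin d × Bool, l1Norm (nbr z e) = l1Norm z - 1 := by
      have key : ∀ c : ℤ, |z i + c| = |z i| - 1 →
          l1Norm (fun j => z j + if j = i then c else 0) = l1Norm z - 1 := by
        intro c hc
        unfold l1Norm
        rw [← Finset.add_sum_erase _ _ (Finset.mem_univ i),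
          ← Finset.add_sum_erase Finset.univ (fun j => |z j|) (Finset.mem_univ i)]
        have : ∑ j ∈ Finset.univ.erase i, |z j + if j = i then c else 0| =
            ∑ j ∈ Finset.univ.erase i, |z j| :=
          Finset.sum_congr rfl fun j hj => by simp [Finset.ne_of_mem_erase hj]
        rw [this]
        simp only [if_true, hc]
        ring
      rcases lt_or_gt_of_ne hi with hneg | hpos
      · refine ⟨(i, true), ?_⟩
        rw [← key 1 (by rw [abs_of_neg hneg, abs_of_nonpos (by omega)]; ring)]
        congr 1
        ext j; by_cases h : j = i <;> simp [nbr, h]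
      · refine ⟨(i, false), ?_⟩
        rw [← key (-1) (by rw [abs_of_pos hpos, abs_of_nonneg (by omega)]; ring)]
        congr 1
        ext j; by_cases h : j = i <;> simp [nbr, h]; ring
    have h1 := ih hh x (nbr z e) (by push_cast at hz; omega)
    have h2 := hh (z + x) e
    rw [nbr_add, abs_le] at h2
    omega

lemma Lip.le_add_l1Norm {d : ℕ} {h : Site d → ℤ} (hh : Lip h) (x y : Site d) :
    h y ≤ h x + l1Norm (y - x) := by
  have := DualRSOS.le_add_l1Norm (l1Norm (y - x)).toNat hh x (y - x)
    (by rw [Int.toNat_of_nonneg (l1Norm_nonneg _)])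
  simpa using this

lemma finite_l1Norm_le {d : ℕ} (K : ℤ) : {x : Site d | l1Norm x ≤ K}.Finite := by
  refine (Set.Finite.pi' (t := fun _ : Fin d => Set.Icc (-K) K)
    (fun _ => Set.finite_Icc _ _)).subset fun x hx i => ?_
  rw [Set.mem_Icc, ← abs_le]
  exact (Finset.single_le_sum (f := fun i => |x i|) (fun _ _ => abs_nonneg _)
    (Finset.mem_univ i)).trans hx

lemma exists_eq_iInf {d : ℕ} {h : Site d → ℤ} (hb : ∀ x, 0 ≤ h x) : ∃ x, h x = ⨅ y, h y :=
  Int.csInf_mem (Set.range_nonempty h) ⟨0, by rintro _ ⟨x, rfl⟩; exact hb x⟩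

lemma iInf_le_apply {d : ℕ} {h : Site d → ℤ} (hb : ∀ x, 0 ≤ h x) (x : Site d) :
    ⨅ y, h y ≤ h x :=
  ciInf_le ⟨0, by rintro _ ⟨x, rfl⟩; exact hb x⟩ x

/-! ### Minimum of the discrete surface and a measurable choice of minimiser. -/

/-- The discrete time dynamics started from the well. -/
abbrev well {d : ℕ} (β : Marks d) (n : ℕ) : Site d → ℤ := evol β l1Norm n

lemma l1Norm_le_well {d : ℕ} (β : Marks d) (n : ℕ) (x : Site d) : l1Norm x ≤ well β n x :=
  le_evol β _ n x

lemma well_nonneg {d : ℕ} (β : Marks d) (n : ℕ) (x : Site d) : 0 ≤ well β n x :=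
  (l1Norm_nonneg x).trans (l1Norm_le_well β n x)

/-- The minimum height of the discrete time dynamics started from the well. -/
noncomputable def minWell {d : ℕ} (β : Marks d) (n : ℕ) : ℤ := ⨅ x, well β n x

lemma minWell_le {d : ℕ} (β : Marks d) (n : ℕ) (x : Site d) : minWell β n ≤ well β n x :=
  iInf_le_apply (well_nonneg β n) x

lemma minWell_nonneg {d : ℕ} (β : Marks d) (n : ℕ) : 0 ≤ minWell β n :=
  le_ciInf (well_nonneg β n)

lemma well_zero_le {d : ℕ} (β : Marks d) (n : ℕ) :
    well β n 0 ≤ ∑ j ∈ Finset.range n, if β (j, 0) then 1 else 0 := by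
  induction n with
  | zero => simp [evol]
  | succ n ih =>
    rw [Finset.sum_range_succ]
    have h1 : well β (n + 1) 0 ≤ well β n 0 + if β (n, 0) then 1 else 0 := by
      simp only [well, evol, DualRSOS.step]
      split_ifs
      · exact rsosUpdate_le _ _
      · simp
    omega

lemma minWell_le_sum {d : ℕ} (β : Marks d) (n : ℕ) :
    minWell β n ≤ ∑ j ∈ Finset.range n, if β (j, 0) then 1 else 0 :=
  (minWell_le β n 0).trans (well_zero_le β n)

lemma minWell_le_nat {d : ℕ} (β : Marks d) (n : ℕ) : minWell β n ≤ n := by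
  refine (minWell_le_sum β n).trans ?_
  calc ∑ j ∈ Finset.range n, (if β (j, 0) then 1 else 0 : ℤ) ≤ ∑ j ∈ Finset.range n, 1 :=
        Finset.sum_le_sum fun j _ => by split_ifs <;> simp
    _ = n := by simp

open Classical in
/-- A site of minimal height, the first one in a fixed enumeration of the sites. -/
noncomputable def argmin {d : ℕ} (n : ℕ) (β : Marks d) : Site d :=
  (Encodable.decode (Nat.find (p := fun k => ∃ x : Site d, Encodable.encode x = k ∧
    well β n x = minWell β n)
    (by obtain ⟨x, hx⟩ := exists_eq_iInf (well_nonneg β n); exact ⟨_, x, rfl, hx⟩))).getD 0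

-- Describes the minimiser by countably many comparisons of heights; this form yields its
-- measurability.
open Classical in
lemma argmin_eq_iff {d : ℕ} (n : ℕ) (β : Marks d) (x : Site d) :
    argmin n β = x ↔ (∀ y, well β n x ≤ well β n y) ∧
      ∀ y : Site d, Encodable.encode y < Encodable.encode x → well β n x < well β n y := by
  have hex : ∃ k, ∃ x : Site d, Encodable.encode x = k ∧ well β n x = minWell β n := by
    obtain ⟨x, hx⟩ := exists_eq_iInf (well_nonneg β n)
    exact ⟨_, x, rfl, hx⟩
  obtain ⟨z, hz1, hz2⟩ := Nat.find_spec hex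
  have hz : argmin n β = z := by
    unfold argmin
    rw [← hz1]
    simp
  have hmin : ∀ y : Site d, Encodable.encode y < Encodable.encode z →
      well β n y ≠ minWell β n := fun y hy h => Nat.find_min hex (hz1 ▸ hy) ⟨y, rfl, h⟩
  rw [hz]
  constructor
  · rintro rfl
    exact ⟨fun y => hz2 ▸ minWell_le β n y, fun y hy =>
      lt_of_le_of_ne (hz2 ▸ minWell_le β n y) fun h => hmin y hy (h ▸ hz2)⟩
  · rintro ⟨h1, h2⟩
    have hx : well β n x = minWell β n :=
      le_antisymm (hz2 ▸ h1 z) (minWell_le β n x)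
    rcases lt_trichotomy (Encodable.encode z) (Encodable.encode x) with h | h | h
    · exact absurd (h2 z h) (by rw [hx, hz2]; exact lt_irrefl _)
    · exact Encodable.encode_injective h
    · exact absurd hx (hmin x h)

lemma well_argmin {d : ℕ} (n : ℕ) (β : Marks d) : well β n (argmin n β) = minWell β n :=
  le_antisymm (le_ciInf ((argmin_eq_iff n β _).1 rfl).1) (minWell_le β n _)

/-! ### Restarting from the minimiser: pathwise subadditivity. -/

/-- Marks given by `α` up to time `n`, and by `α'`, shifted by `n` in time and by `X α` in space,
afterwards. -/
def splice {d : ℕ} (n : ℕ) (X : Marks d → Site d) (a : Marks d × Marks d) : Marks d :=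
  fun p => if p.1 < n then a.1 p else a.2 (p.1 - n, p.2 - X a.1)

lemma well_splice {d : ℕ} (n : ℕ) (X : Marks d → Site d) (a : Marks d × Marks d) :
    well (splice n X a) n = well a.1 n :=
  evol_congr _ _ fun p hp => by simp [splice, hp]

/-- At time `n` the surface lies below the well of height `minWell a.1 n` centred at the minimiser,
and attractiveness preserves this. Seen from the minimiser, the later marks are exactly `a.2`. -/
lemma minWell_splice_le {d : ℕ} (n k : ℕ) (a : Marks d × Marks d) :
    minWell (splice n (argmin n) a) (n + k) ≤ minWell a.1 n + minWell a.2 k := by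
  obtain ⟨z, hz⟩ := exists_eq_iInf (well_nonneg a.2 k)
  refine (minWell_le _ _ (z + argmin n a.1)).trans ?_
  rw [well, evol_add, evol_translate]
  have h1 : (fun p : ℕ × Site d => splice n (argmin n) a (p.1 + n, p.2 + argmin n a.1)) = a.2 := by
    ext p
    simp [splice]
  have h2 : ∀ z, evol (splice n (argmin n) a) l1Norm n (z + argmin n a.1) ≤
      l1Norm z + minWell a.1 n := by
    intro z
    have := (lip_l1Norm.evol (splice n (argmin n) a) n).le_add_l1Norm (argmin n a.1)
      (z + argmin n a.1)
    rw [add_sub_cancel_right] at this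
    have h3 := congrFun (well_splice n (argmin n) a) (argmin n a.1)
    rw [well_argmin] at h3
    simp only [well] at h3
    omega
  rw [h1]
  refine (evol_mono (H' := fun z => l1Norm z + minWell a.1 n) ?_ ?_ h2 a.2 k z).trans ?_
  · intro x e
    have := (lip_l1Norm.evol (splice n (argmin n) a) n) (x + argmin n a.1) e
    rwa [nbr_add] at this
  · intro x e
    have := lip_l1Norm x e
    rwa [add_sub_add_right_eq_sub]
  · rw [evol_add_const]
    have : evol a.2 l1Norm k z = minWell a.2 k := hz
    omega

lemma measurable_rsosUpdate {d : ℕ} {Ω : Type*} [MeasurableSpace Ω] {h : Ω → Site d → ℤ}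
    (hh : ∀ x, Measurable fun ω => h ω x) (x : Site d) :
    Measurable fun ω => rsosUpdate (h ω) x := by
  simp only [rsosUpdate_eq]
  refine Measurable.ite ?_ ((hh x).add_const 1) (hh x)
  simp only [Set.ofPred_forall]
  refine MeasurableSet.iInter fun e => ?_
  exact (measurable_of_countable (fun a : ℤ × ℤ => |a.1 + 1 - a.2|)).comp
    ((hh x).prodMk (hh (nbr x e))) (measurableSet_Iic (a := 1))

lemma measurable_evol {d : ℕ} (H : Site d → ℤ) (n : ℕ) (x : Site d) :
    Measurable fun β : Marks d => evol β H n x := by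
  induction n generalizing x with
  | zero => exact measurable_const
  | succ n ih =>
    simp only [evol, DualRSOS.step]
    refine Measurable.ite ?_ (measurable_rsosUpdate ih x) (ih x)
    exact (measurable_pi_apply (X := fun _ : ℕ × Site d => Bool) (n, x)) (measurableSet_singleton true)

lemma measurable_argmin {d : ℕ} (n : ℕ) : Measurable (argmin (d := d) n) := by
  refine measurable_to_countable' fun x => ?_
  have : argmin n ⁻¹' {x} = (⋂ y, {β | well β n x ≤ well β n y}) ∩
      ⋂ (y : Site d) (_ : Encodable.encode y < Encodable.encode x),
        {β | well β n x < well β n y} := by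
    ext β
    simp [argmin_eq_iff]
  rw [this]
  refine (MeasurableSet.iInter fun y => ?_).inter
    (MeasurableSet.iInter fun y => MeasurableSet.iInter fun _ => ?_)
  · exact measurableSet_le (measurable_evol _ n x) (measurable_evol _ n y)
  · exact measurableSet_lt (measurable_evol _ n x) (measurable_evol _ n y)

lemma measurable_minWell {d : ℕ} (n : ℕ) : Measurable fun β : Marks d => minWell β n := by
  simp only [← well_argmin]
  exact (measurable_from_prod_countable_left (f := fun a : Marks d × Site d => well a.1 n a.2)
    fun x => measurable_evol _ n x).comp (measurable_id.prodMk (measurable_argmin n))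

lemma measurable_splice {d : ℕ} (n : ℕ) {X : Marks d → Site d} (hX : Measurable X) :
    Measurable (splice n X) := by
  refine measurable_pi_iff.2 fun p => ?_
  unfold splice
  by_cases h : p.1 < n
  · simp only [h, if_true]
    exact (measurable_pi_apply p).comp measurable_fst
  · simp only [h, if_false]
    exact (measurable_from_prod_countable_left
      (f := fun a : Marks d × Site d => a.1 (p.1 - n, p.2 - a.2))
      fun x => measurable_pi_apply (X := fun _ : ℕ × Site d => Bool) (p.1 - n, p.2 - x)).comp
        (measurable_snd.prodMk (hX.comp measurable_fst))

/-! ### Independent marks: subadditivity of means and second moments. -/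

/-- The law of independent marks with distribution `ν`. -/
noncomputable abbrev marksLaw (d : ℕ) (ν : Measure Bool) [IsProbabilityMeasure ν] :
    Measure (Marks d) := Measure.infinitePi fun _ : ℕ × Site d => ν

lemma marksLaw_shift {d : ℕ} (ν : Measure Bool) [IsProbabilityMeasure ν] (n : ℕ) (y : Site d)
    (s : Finset (ℕ × Site d)) (t : ℕ × Site d → Set Bool) :
    marksLaw d ν {α | ∀ p ∈ s, ¬ p.1 < n → α (p.1 - n, p.2 - y) ∈ t p} =
      ∏ p ∈ s with ¬ p.1 < n, ν (t p) := by
  let g : {p : ℕ × Site d // ¬ p.1 < n} → ℕ × Site d := fun p => (p.1.1 - n, p.1.2 - y)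
  have hg : Function.Injective g := by
    rintro ⟨⟨j, x⟩, hj⟩ ⟨⟨k, z⟩, hk⟩ h
    simp only [g, Prod.mk.injEq, sub_left_inj] at h
    simp only at hj hk
    simp only [Subtype.mk.injEq, Prod.mk.injEq]
    exact ⟨by omega, h.2⟩
  have h1 := Measure.map_infinitePi_infinitePi_of_inj (P := fun _ : ℕ × Site d => ν) hg
  have h2 := Measure.infinitePi_pi (fun _ : {p : ℕ × Site d // ¬ p.1 < n} => ν)
    (s := s.subtype fun p => ¬ p.1 < n) (t := fun p => t p.1) (fun _ _ => MeasurableSet.of_discrete)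
  rw [← h1, Measure.map_apply (by fun_prop)
    (MeasurableSet.pi (Finset.countable_toSet _) fun _ _ => MeasurableSet.of_discrete)] at h2
  rw [← Finset.prod_subtype_eq_prod_filter, ← h2]
  congr 1
  ext α
  simp only [Set.mem_pi, g, Set.mem_preimage, Finset.mem_coe, Finset.mem_subtype,
    Set.mem_ofPred_eq, Subtype.forall]
  exact forall_congr' fun p => forall_comm

/-- A spatial shift chosen from an independent field leaves the i.i.d. law of the later marks
unchanged. In the application the shift depends only on marks before `n`, but invariance needs only
independence from the second field. -/
lemma map_splice {d : ℕ} (ν : Measure Bool) [IsProbabilityMeasure ν] (n : ℕ)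
    {X : Marks d → Site d} (hX : Measurable X) :
    ((marksLaw d ν).prod (marksLaw d ν)).map (splice n X) = marksLaw d ν := by
  refine Measure.eq_infinitePi _ fun s t ht => ?_
  have hm : MeasurableSet ((s : Set (ℕ × Site d)).pi t) :=
    MeasurableSet.pi (Finset.countable_toSet _) fun i _ => ht i
  rw [Measure.map_apply (measurable_splice n hX) hm,
    Measure.prod_apply (measurable_splice n hX hm)]
  -- For fixed `α`, the constraints before time `n` are decided, and the later ones have a
  -- probability that does not depend on `X α`.
  have hsec : ∀ α, marksLaw d ν (Prod.mk α ⁻¹' (splice n X ⁻¹' (s : Set (ℕ × Site d)).pi t)) =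
      (((s.filter fun p => p.1 < n : Finset _) : Set (ℕ × Site d)).pi t).indicator
        (fun _ => ∏ p ∈ s with ¬ p.1 < n, ν (t p)) α := by
    intro α
    by_cases hα : α ∈ ((s.filter fun p => p.1 < n : Finset _) : Set (ℕ × Site d)).pi t
    · rw [Set.indicator_of_mem hα, ← marksLaw_shift ν n (X α) s t]
      congr 1
      ext α'
      simp only [Set.mem_preimage, Set.mem_pi, Finset.mem_coe, splice, Set.mem_ofPred_eq,
        Finset.mem_filter, and_imp] at hα ⊢
      refine forall₂_congr fun p hp => ?_
      by_cases h : p.1 < n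
      · simp [h, hα p hp h]
      · simp [h]
    · rw [Set.indicator_of_notMem hα]
      refine (congrArg _ (Set.eq_empty_of_forall_notMem fun α' hα' => ?_)).trans measure_empty
      refine hα fun p hp => ?_
      rw [Finset.mem_coe, Finset.mem_filter] at hp
      have := hα' p hp.1
      simpa [splice, hp.2] using this
  simp only [hsec]
  rw [lintegral_indicator (MeasurableSet.pi (Finset.countable_toSet _) fun i _ => ht i),
    setLIntegral_const, Measure.infinitePi_pi _ fun i _ => ht i, mul_comm,
    Finset.prod_filter_mul_prod_filter_not]

lemma integral_splice {d : ℕ} (ν : Measure Bool) [IsProbabilityMeasure ν] (n : ℕ)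
    {X : Marks d → Site d} (hX : Measurable X) {F : Marks d → ℝ} (hF : Measurable F) :
    ∫ β, F β ∂marksLaw d ν =
      ∫ a, F (splice n X a) ∂((marksLaw d ν).prod (marksLaw d ν)) := by
  rw [← map_splice ν n hX, integral_map (measurable_splice n hX).aemeasurable
    hF.aestronglyMeasurable, map_splice ν n hX]

lemma measurable_minWell_real {d : ℕ} (n : ℕ) :
    Measurable fun β : Marks d => (minWell β n : ℝ) :=
  (measurable_of_countable (fun k : ℤ => (k : ℝ))).comp (measurable_minWell n)

lemma integrable_of_bounded {Ω : Type*} [MeasurableSpace Ω] {μ : Measure Ω} [IsFiniteMeasure μ]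
    {F : Ω → ℝ} (hF : Measurable F) (C : ℝ) (hC : ∀ ω, |F ω| ≤ C) : Integrable F μ :=
  Integrable.of_bound hF.aestronglyMeasurable C (Filter.Eventually.of_forall hC)

lemma minWell_real_nonneg {d : ℕ} (β : Marks d) (n : ℕ) : (0 : ℝ) ≤ minWell β n := by
  exact_mod_cast minWell_nonneg β n

lemma minWell_real_le {d : ℕ} (β : Marks d) (n : ℕ) : (minWell β n : ℝ) ≤ n := by
  exact_mod_cast minWell_le_nat β n

lemma integrable_minWell_pow {d : ℕ} (ν : Measure Bool) [IsProbabilityMeasure ν] (n k : ℕ) :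
    Integrable (fun β => (minWell β n : ℝ) ^ k) (marksLaw d ν) :=
  integrable_of_bounded ((measurable_minWell_real n).pow_const k) ((n : ℝ) ^ k) fun β => by
    rw [abs_of_nonneg (pow_nonneg (minWell_real_nonneg β n) k)]
    exact pow_le_pow_left₀ (minWell_real_nonneg β n) (minWell_real_le β n) k

lemma integrable_minWell {d : ℕ} (ν : Measure Bool) [IsProbabilityMeasure ν] (n : ℕ) :
    Integrable (fun β => (minWell β n : ℝ)) (marksLaw d ν) := by
  simpa using integrable_minWell_pow ν n 1

lemma integral_minWell_add_le {d : ℕ} (ν : Measure Bool) [IsProbabilityMeasure ν] (n k : ℕ) :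
    ∫ β, (minWell β (n + k) : ℝ) ∂marksLaw d ν ≤
      ∫ β, (minWell β n : ℝ) ∂marksLaw d ν + ∫ β, (minWell β k : ℝ) ∂marksLaw d ν := by
  rw [integral_splice ν n (measurable_argmin n) (measurable_minWell_real _)]
  have h1 := (integrable_minWell (d := d) ν n).comp_fst (marksLaw d ν)
  have h2 := (integrable_minWell (d := d) ν k).comp_snd (marksLaw d ν)
  calc _ ≤ ∫ a : Marks d × Marks d, ((minWell a.1 n : ℝ) + minWell a.2 k)
        ∂((marksLaw d ν).prod (marksLaw d ν)) := by
        refine integral_mono_of_nonneg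
          (Filter.Eventually.of_forall fun a => minWell_real_nonneg _ _) (h1.add h2)
          (Filter.Eventually.of_forall fun a => ?_)
        simp only
        exact_mod_cast minWell_splice_le n k a
    _ = _ := by
        rw [integral_add h1 h2, integral_fun_fst (fun β : Marks d => (minWell β n : ℝ)),
          integral_fun_snd (fun β : Marks d => (minWell β k : ℝ))]
        simp

/-- Square the pathwise bound; independence of the two pieces factorises the cross term. -/
lemma integral_minWell_sq_le {d : ℕ} (ν : Measure Bool) [IsProbabilityMeasure ν] (n : ℕ) :
    ∫ β, (minWell β (n + n) : ℝ) ^ 2 ∂marksLaw d ν ≤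
      2 * ∫ β, (minWell β n : ℝ) ^ 2 ∂marksLaw d ν +
        2 * (∫ β, (minWell β n : ℝ) ∂marksLaw d ν) ^ 2 := by
  rw [integral_splice ν n (measurable_argmin n) ((measurable_minWell_real _).pow_const 2)]
  have h1 := (integrable_minWell_pow (d := d) ν n 2).comp_fst (marksLaw d ν)
  have h2 := (integrable_minWell_pow (d := d) ν n 2).comp_snd (marksLaw d ν)
  have h3 := ((integrable_minWell (d := d) ν n).mul_prod (integrable_minWell (d := d) ν n)).const_mul
    2
  calc _ ≤ ∫ a : Marks d × Marks d, ((minWell a.1 n : ℝ) ^ 2 + (minWell a.2 n : ℝ) ^ 2 +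
          2 * ((minWell a.1 n : ℝ) * minWell a.2 n))
        ∂((marksLaw d ν).prod (marksLaw d ν)) := by
        refine integral_mono_of_nonneg
          (Filter.Eventually.of_forall fun a => sq_nonneg _) ((h1.add h2).add h3)
          (Filter.Eventually.of_forall fun a => ?_)
        have h4 : (minWell (splice n (argmin n) a) (n + n) : ℝ) ≤ minWell a.1 n + minWell a.2 n := by
          exact_mod_cast minWell_splice_le n n a
        refine (pow_le_pow_left₀ (minWell_real_nonneg _ _) h4 2).trans (le_of_eq ?_)
        ring
    _ = _ := by
        rw [integral_add (f := fun a : Marks d × Marks d => (minWell a.1 n : ℝ) ^ 2 +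
            (minWell a.2 n : ℝ) ^ 2) (h1.add h2) h3, integral_add h1 h2,
          integral_fun_fst (fun β : Marks d => (minWell β n : ℝ) ^ 2),
          integral_fun_snd (fun β : Marks d => (minWell β n : ℝ) ^ 2), integral_const_mul,
          integral_prod_mul (fun β : Marks d => (minWell β n : ℝ))
            (fun β : Marks d => (minWell β n : ℝ))]
        simp
        ring

/-- Independence of a mark from the past, read off from `splice` with the zero spatial shift. -/
lemma integral_mul_mark {d : ℕ} (ν : Measure Bool) [IsProbabilityMeasure ν] (n : ℕ) (x : Site d)
    {F : Marks d → ℝ} (hF : Measurable F)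
    (hpast : ∀ β β' : Marks d, (∀ p : ℕ × Site d, p.1 < n → β p = β' p) → F β = F β') :
    ∫ β, F β * (if β (n, x) then 1 else 0) ∂marksLaw d ν =
      (∫ β, F β ∂marksLaw d ν) * ν.real {true} := by
  have hm : ∀ p : ℕ × Site d, Measurable fun β : Marks d => if β p then (1 : ℝ) else 0 := fun p =>
    (measurable_of_countable (fun b : Bool => if b then (1 : ℝ) else 0)).comp
      (measurable_pi_apply p)
  rw [integral_splice ν n (F := fun β => F β * if β (n, x) then 1 else 0)
    (measurable_const (a := (0 : Site d))) (hF.mul (hm (n, x)))]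
  have h1 : ∀ a : Marks d × Marks d, F (splice n (fun _ => 0) a) = F a.1 := fun a =>
    hpast _ _ fun p hp => by simp [splice, hp]
  have h2 : ∀ a : Marks d × Marks d, splice n (fun _ => 0) a (n, x) = a.2 (0, x) := fun a => by
    simp [splice]
  simp only [h1, h2]
  rw [integral_prod_mul F fun β : Marks d => if β (0, x) then (1 : ℝ) else 0]
  congr 1
  have h3 : MeasurePreserving (fun β : Marks d => β (0, x)) (marksLaw d ν) ν :=
    measurePreserving_eval_infinitePi (fun _ : ℕ × Site d => ν) (0, x)
  have h4 : (fun β : Marks d => if β (0, x) then (1 : ℝ) else 0) =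
      ((fun β : Marks d => β (0, x)) ⁻¹' {true}).indicator 1 := by
    ext β
    by_cases h : β (0, x) = true <;> simp [Set.indicator, h]
  rw [h4, integral_indicator_one (h3.measurable (measurableSet_singleton true)),
    h3.measureReal_preimage (measurableSet_singleton true).nullMeasurableSet]

/-! ### Exponential weights and linear growth of the mean minimum. -/

lemma summable_zpow_abs {θ : ℝ} (h0 : 0 < θ) (h1 : θ < 1) : Summable fun k : ℤ => θ ^ |k| := by
  have h : Summable fun k : ℕ => θ ^ k := summable_geometric_of_lt_one h0.le h1
  refine Summable.of_nat_of_neg ?_ ?_ <;> simpa using h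

lemma summable_zpow_l1Norm {θ : ℝ} (h0 : 0 < θ) (h1 : θ < 1) (d : ℕ) :
    Summable fun x : Site d => θ ^ l1Norm x := by
  induction d with
  | zero => exact summable_of_hasFiniteSupport (Set.toFinite _)
  | succ d ih =>
    rw [← (Fin.consEquiv fun _ : Fin (d + 1) => ℤ).summable_iff]
    have h2 := (summable_zpow_abs h0 h1).mul_of_nonneg ih (fun k => by positivity)
      (fun x => by simp only [Pi.zero_apply]; positivity)
    refine h2.congr fun a => ?_
    simp only [Function.comp, Fin.consEquiv_apply, l1Norm, Fin.sum_univ_succ, Fin.cons_zero,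
      Fin.cons_succ]
    rw [zpow_add₀ h0.ne']

/-- The bijection of the lattice that moves each site one step in the direction `e`. -/
def nbrEquiv {d : ℕ} (e : Fin d × Bool) : Site d ≃ Site d where
  toFun x := nbr x e
  invFun x := nbr x (e.1, !e.2)
  left_inv x := nbr_nbr x e
  right_inv x := by simpa using nbr_nbr x (e.1, !e.2)

open Classical in
/-- The indicator of the event that `x` is a local minimum of the discrete time surface. -/
noncomputable def locMin {d : ℕ} (n : ℕ) (x : Site d) (β : Marks d) : ℝ :=
  if ∀ e, well β n x ≤ well β n (nbr x e) then 1 else 0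

lemma locMin_nonneg {d : ℕ} (n : ℕ) (x : Site d) (β : Marks d) : 0 ≤ locMin n x β := by
  unfold locMin; split_ifs <;> simp

lemma locMin_le_one {d : ℕ} (n : ℕ) (x : Site d) (β : Marks d) : locMin n x β ≤ 1 := by
  unfold locMin; split_ifs <;> simp

lemma measurable_locMin {d : ℕ} (n : ℕ) (x : Site d) : Measurable (locMin n x) := by
  classical
  refine Measurable.ite ?_ measurable_const measurable_const
  simp only [Set.ofPred_forall]
  exact MeasurableSet.iInter fun e =>
    measurableSet_le (measurable_evol _ n x) (measurable_evol _ n _)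

/-- The exponential weight of the height at `x`. -/
noncomputable def weight {d : ℕ} (θ : ℝ) (n : ℕ) (x : Site d) (β : Marks d) : ℝ :=
  θ ^ well β n x

lemma measurable_weight {d : ℕ} (θ : ℝ) (n : ℕ) (x : Site d) : Measurable (weight θ n x) :=
  (measurable_of_countable (fun k : ℤ => θ ^ k)).comp (measurable_evol _ n x)

lemma weight_nonneg {d : ℕ} {θ : ℝ} (h0 : 0 < θ) (n : ℕ) (x : Site d) (β : Marks d) :
    0 ≤ weight θ n x β := by
  unfold weight; positivity

lemma weight_le {d : ℕ} {θ : ℝ} (h0 : 0 < θ) (h1 : θ ≤ 1) (n : ℕ) (x : Site d) (β : Marks d) :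
    weight θ n x β ≤ θ ^ l1Norm x :=
  zpow_le_zpow_right_of_le_one₀ h0 h1 (l1Norm_le_well β n x)

lemma zpow_l1Norm_le_one {d : ℕ} {θ : ℝ} (h0 : 0 < θ) (h1 : θ ≤ 1) (x : Site d) :
    θ ^ l1Norm x ≤ 1 := by
  simpa using zpow_le_zpow_right_of_le_one₀ h0 h1 (l1Norm_nonneg x)

lemma weight_succ {d : ℕ} {θ : ℝ} (h0 : 0 < θ) (n : ℕ) (x : Site d) (β : Marks d) :
    weight θ (n + 1) x β =
      weight θ n x β -
        (1 - θ) * (weight θ n x β * locMin n x β * (if β (n, x) then 1 else 0)) := by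
  unfold weight locMin
  simp only [well, evol]
  rw [(lip_l1Norm.evol β n).step_eq]
  by_cases hb : β (n, x) = true <;>
    by_cases hl : ∀ e, evol β l1Norm n x ≤ evol β l1Norm n (nbr x e)
  · simp only [hb, hl, true_and, implies_true, if_true, zpow_add_one₀ h0.ne']
    ring
  · simp only [hb, hl, and_false, if_false, if_true]
    ring
  · simp [hb]
  · simp [hb]

/-- A site that is not a local minimum has a neighbour exactly one lower, whose weight is larger by
the factor `1 / θ`. -/
lemma weight_le_locMin_add {d : ℕ} {θ : ℝ} (h0 : 0 < θ) (n : ℕ) (x : Site d) (β : Marks d) :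
    weight θ n x β ≤ weight θ n x β * locMin n x β + θ * ∑ e, weight θ n (nbr x e) β := by
  by_cases hl : ∀ e, well β n x ≤ well β n (nbr x e)
  · have : locMin n x β = 1 := if_pos hl
    rw [this, mul_one]
    have : 0 ≤ θ * ∑ e, weight θ n (nbr x e) β :=
      mul_nonneg h0.le (Finset.sum_nonneg fun e _ => weight_nonneg h0 n _ β)
    linarith
  · have h2 : locMin n x β = 0 := if_neg hl
    rw [h2, mul_zero, zero_add]
    push Not at hl
    obtain ⟨e, he⟩ := hl
    have hlip := lip_l1Norm.evol β n x e
    have h3 : well β n x = well β n (nbr x e) + 1 := by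
      rw [abs_le] at hlip
      simp only [well] at *
      omega
    have h4 : weight θ n x β = θ * weight θ n (nbr x e) β := by
      unfold weight
      rw [h3, zpow_add_one₀ h0.ne', mul_comm]
    rw [h4]
    exact mul_le_mul_of_nonneg_left (Finset.single_le_sum (f := fun e => weight θ n (nbr x e) β)
      (fun e _ => weight_nonneg h0 n _ β) (Finset.mem_univ e)) h0.le

section Expectation

variable {d : ℕ} (ν : Measure Bool) [IsProbabilityMeasure ν] {θ : ℝ}

lemma integrable_weight (h0 : 0 < θ) (h1 : θ ≤ 1) (n : ℕ) (x : Site d) :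
    Integrable (weight θ n x) (marksLaw d ν) :=
  integrable_of_bounded (measurable_weight θ n x) 1 fun β => by
    rw [abs_of_nonneg (weight_nonneg h0 n x β)]
    exact (weight_le h0 h1 n x β).trans (zpow_l1Norm_le_one h0 h1 x)

lemma integrable_weight_mul_locMin (h0 : 0 < θ) (h1 : θ ≤ 1) (n : ℕ) (x : Site d) :
    Integrable (fun β => weight θ n x β * locMin n x β) (marksLaw d ν) :=
  integrable_of_bounded ((measurable_weight θ n x).mul (measurable_locMin n x)) 1 fun β => by
    rw [abs_of_nonneg (mul_nonneg (weight_nonneg h0 n x β) (locMin_nonneg n x β))]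
    exact mul_le_one₀ ((weight_le h0 h1 n x β).trans (zpow_l1Norm_le_one h0 h1 x))
      (locMin_nonneg n x β) (locMin_le_one n x β)

lemma integral_weight_le (h0 : 0 < θ) (h1 : θ ≤ 1) (n : ℕ) (x : Site d) :
    ∫ β, weight θ n x β ∂marksLaw d ν ≤ θ ^ l1Norm x := by
  calc _ ≤ ∫ _, θ ^ l1Norm x ∂marksLaw d ν :=
        integral_mono (integrable_weight ν h0 h1 n x) (integrable_const _)
          fun β => weight_le h0 h1 n x β
    _ = _ := by simp

lemma summable_integral_weight (h0 : 0 < θ) (h1 : θ < 1) (n : ℕ) :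
    Summable fun x : Site d => ∫ β, weight θ n x β ∂marksLaw d ν :=
  (summable_zpow_l1Norm h0 h1 d).of_nonneg_of_le
    (fun x => integral_nonneg fun β => weight_nonneg h0 n x β)
    (fun x => integral_weight_le ν h0 h1.le n x)

lemma integral_weight_mul_locMin_le (h0 : 0 < θ) (h1 : θ ≤ 1) (n : ℕ) (x : Site d) :
    ∫ β, weight θ n x β * locMin n x β ∂marksLaw d ν ≤ ∫ β, weight θ n x β ∂marksLaw d ν :=
  integral_mono (integrable_weight_mul_locMin ν h0 h1 n x) (integrable_weight ν h0 h1 n x)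
    fun β => mul_le_of_le_one_right (weight_nonneg h0 n x β) (locMin_le_one n x β)

lemma summable_integral_weight_mul_locMin (h0 : 0 < θ) (h1 : θ < 1) (n : ℕ) :
    Summable fun x : Site d => ∫ β, weight θ n x β * locMin n x β ∂marksLaw d ν :=
  (summable_integral_weight ν h0 h1 n).of_nonneg_of_le
    (fun x => integral_nonneg fun β =>
      mul_nonneg (weight_nonneg h0 n x β) (locMin_nonneg n x β))
    (fun x => integral_weight_mul_locMin_le ν h0 h1.le n x)

lemma integral_weight_succ (h0 : 0 < θ) (h1 : θ ≤ 1) (n : ℕ) (x : Site d) :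
    ∫ β, weight θ (n + 1) x β ∂marksLaw d ν =
      ∫ β, weight θ n x β ∂marksLaw d ν -
        (1 - θ) * ν.real {true} * ∫ β, weight θ n x β * locMin n x β ∂marksLaw d ν := by
  have hm : Measurable fun β : Marks d => if β (n, x) then (1 : ℝ) else 0 :=
    (measurable_of_countable (fun b : Bool => if b then (1 : ℝ) else 0)).comp
      (measurable_pi_apply (X := fun _ : ℕ × Site d => Bool) (n, x))
  have hpast : ∀ β β' : Marks d, (∀ p : ℕ × Site d, p.1 < n → β p = β' p) →
      weight θ n x β * locMin n x β = weight θ n x β' * locMin n x β' := by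
    intro β β' h
    simp only [weight, locMin, well, evol_congr l1Norm n h]
  simp only [weight_succ h0]
  rw [integral_sub (integrable_weight ν h0 h1 n x), integral_const_mul,
    integral_mul_mark ν n x (F := fun β => weight θ n x β * locMin n x β) ((measurable_weight θ n x).mul (measurable_locMin n x)) hpast]
  · ring
  · refine Integrable.const_mul (integrable_of_bounded
      (((measurable_weight θ n x).mul (measurable_locMin n x)).mul hm) 1 fun β => ?_) _
    simp only [Pi.mul_apply]
    rw [abs_of_nonneg (mul_nonneg (mul_nonneg (weight_nonneg h0 n x β) (locMin_nonneg n x β))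
      (by split_ifs <;> simp))]
    exact mul_le_one₀ (mul_le_one₀ ((weight_le h0 h1 n x β).trans (zpow_l1Norm_le_one h0 h1 x))
      (locMin_nonneg n x β) (locMin_le_one n x β)) (by split_ifs <;> simp) (by split_ifs <;> simp)

lemma tsum_integral_weight_le (h0 : 0 < θ) (h1 : θ < 1) (n : ℕ) :
    ∑' x : Site d, ∫ β, weight θ n x β ∂marksLaw d ν ≤
      ∑' x : Site d, ∫ β, weight θ n x β * locMin n x β ∂marksLaw d ν +
        θ * (2 * d) * ∑' x : Site d, ∫ β, weight θ n x β ∂marksLaw d ν := by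
  have hs := summable_integral_weight (d := d) ν h0 h1 n
  have hse : ∀ e : Fin d × Bool, Summable fun x : Site d =>
      ∫ β, weight θ n (nbr x e) β ∂marksLaw d ν := fun e => (nbrEquiv e).summable_iff.2 hs
  have hpt : ∀ x : Site d, ∫ β, weight θ n x β ∂marksLaw d ν ≤
      ∫ β, weight θ n x β * locMin n x β ∂marksLaw d ν +
        θ * ∑ e, ∫ β, weight θ n (nbr x e) β ∂marksLaw d ν := by
    intro x
    rw [← integral_finsetSum _ fun e _ => integrable_weight ν h0 h1.le n (nbr x e),
      ← integral_const_mul, ← integral_add (integrable_weight_mul_locMin ν h0 h1.le n x)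
        ((integrable_finsetSum _ fun e _ => integrable_weight ν h0 h1.le n (nbr x e)).const_mul θ)]
    exact integral_mono (integrable_weight ν h0 h1.le n x)
      ((integrable_weight_mul_locMin ν h0 h1.le n x).add
        ((integrable_finsetSum _ fun e _ => integrable_weight ν h0 h1.le n (nbr x e)).const_mul θ))
      fun β => weight_le_locMin_add h0 n x β
  have hs2 : Summable fun x : Site d => θ * ∑ e, ∫ β, weight θ n (nbr x e) β ∂marksLaw d ν :=
    (summable_sum fun e _ => hse e).mul_left θ
  refine (hs.tsum_le_tsum hpt ((summable_integral_weight_mul_locMin ν h0 h1 n).add hs2)).trans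
    (le_of_eq ?_)
  rw [(summable_integral_weight_mul_locMin ν h0 h1 n).tsum_add hs2, tsum_mul_left,
    Summable.tsum_finsetSum fun e _ => hse e]
  have : ∀ e : Fin d × Bool, ∑' x : Site d, ∫ β, weight θ n (nbr x e) β ∂marksLaw d ν =
      ∑' x : Site d, ∫ β, weight θ n x β ∂marksLaw d ν := fun e =>
    (nbrEquiv e).tsum_eq fun x => ∫ β, weight θ n x β ∂marksLaw d ν
  simp only [this, Finset.sum_const, Finset.card_univ, Fintype.card_prod, Fintype.card_fin,
    Fintype.card_bool, nsmul_eq_mul]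
  push_cast
  ring

lemma tsum_integral_weight_succ_le (h0 : 0 < θ) (h1 : θ ≤ 1 / 4) (hd : θ * (2 * d) ≤ 1 / 2)
    (n : ℕ) :
    ∑' x : Site d, ∫ β, weight θ (n + 1) x β ∂marksLaw d ν ≤
      (1 - ν.real {true} / 4) * ∑' x : Site d, ∫ β, weight θ n x β ∂marksLaw d ν := by
  have h1' : θ < 1 := by linarith
  simp only [integral_weight_succ ν h0 h1'.le]
  rw [(summable_integral_weight ν h0 h1' n).tsum_sub
    ((summable_integral_weight_mul_locMin ν h0 h1' n).mul_left _), tsum_mul_left]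
  have h2 := tsum_integral_weight_le (d := d) ν h0 h1' n
  set A := ∑' x : Site d, ∫ β, weight θ n x β ∂marksLaw d ν
  set B := ∑' x : Site d, ∫ β, weight θ n x β * locMin n x β ∂marksLaw d ν
  have hA : 0 ≤ A := tsum_nonneg fun x => integral_nonneg fun β => weight_nonneg h0 n x β
  -- Each site is a neighbour of `2 * d` others, so `A ≤ B + θ * (2 * d) * A ≤ B + A / 2`. With `1 -
  -- θ ≥ 1 / 2` this gives the loss rate `1 / 4` below.
  have hB : A / 2 ≤ B := by nlinarith
  have hp : 0 ≤ ν.real {true} := measureReal_nonneg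
  have h3 : ν.real {true} * (A / 2) ≤ ν.real {true} * B := mul_le_mul_of_nonneg_left hB hp
  have h4 : (1 - θ) * (ν.real {true} * B) ≥ 1 / 2 * (ν.real {true} * B) :=
    mul_le_mul_of_nonneg_right (by linarith) (mul_nonneg hp (by linarith))
  nlinarith

lemma integral_zpow_minWell_le (h0 : 0 < θ) (h1 : θ ≤ 1 / 4) (hd : θ * (2 * d) ≤ 1 / 2)
    (n : ℕ) :
    ∫ β : Marks d, θ ^ minWell β n ∂marksLaw d ν ≤
      Real.exp (-(ν.real {true} * n / 4)) * ∑' x : Site d, θ ^ l1Norm x := by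
  have h1' : θ < 1 := by linarith
  have hA : ∑' x : Site d, ∫ β, weight θ n x β ∂marksLaw d ν ≤
      (1 - ν.real {true} / 4) ^ n * ∑' x : Site d, θ ^ l1Norm x := by
    induction n with
    | zero => simp [weight, evol]
    | succ n ih =>
      refine (tsum_integral_weight_succ_le ν h0 h1 hd n).trans ?_
      rw [pow_succ', mul_assoc]
      refine mul_le_mul_of_nonneg_left ih ?_
      have : ν.real {true} ≤ 1 := measureReal_le_one
      linarith
  have hint : ∫ β : Marks d, θ ^ minWell β n ∂marksLaw d ν ≤
      ∑' x : Site d, ∫ β, weight θ n x β ∂marksLaw d ν := by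
    have hs : ∀ β : Marks d, Summable fun x : Site d => weight θ n x β := fun β =>
      (summable_zpow_l1Norm h0 h1' d).of_nonneg_of_le (fun x => weight_nonneg h0 n x β)
        (fun x => weight_le h0 h1'.le n x β)
    have hsn : Summable fun x : Site d => ∫ β, ‖weight θ n x β‖ ∂marksLaw d ν := by
      simpa only [Real.norm_of_nonneg (weight_nonneg h0 n _ _)] using
        summable_integral_weight ν h0 h1' n
    rw [(hasSum_integral_of_summable_integral_norm
      (fun x => integrable_weight ν h0 h1'.le n x) hsn).tsum_eq]
    refine integral_mono_of_nonneg (Filter.Eventually.of_forall fun β => ?_) ?_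
      (Filter.Eventually.of_forall fun β => ?_)
    · simp only [Pi.zero_apply]; positivity
    · refine integrable_of_bounded ?_ (∑' x : Site d, θ ^ l1Norm x) fun β => ?_
      · exact Measurable.tsum fun x => measurable_weight θ n x
      · rw [abs_of_nonneg (tsum_nonneg fun x => weight_nonneg h0 n x β)]
        exact (hs β).tsum_le_tsum (fun x => weight_le h0 h1'.le n x β)
          (summable_zpow_l1Norm h0 h1' d)
    · simp only [← well_argmin]
      -- The weight of the minimum is a single term of the total weight.
      exact (hs β).le_tsum (argmin n β) fun x _ => weight_nonneg h0 n x β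
  refine (hint.trans hA).trans ?_
  have h5 : (1 - ν.real {true} / 4) ^ n ≤ Real.exp (-(ν.real {true} * n / 4)) := by
    have h6 : 1 - ν.real {true} / 4 ≤ Real.exp (-(ν.real {true} / 4)) := by
      have := Real.add_one_le_exp (-(ν.real {true} / 4))
      linarith
    have h7 : 0 ≤ 1 - ν.real {true} / 4 := by
      have : ν.real {true} ≤ 1 := measureReal_le_one
      linarith
    refine (pow_le_pow_left₀ h7 h6 n).trans (le_of_eq ?_)
    rw [← Real.exp_nat_mul]
    ring_nf
  exact mul_le_mul_of_nonneg_right h5 (tsum_nonneg fun x => by positivity)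

end Expectation

/-- Jensen's inequality applied to the decay of the mean of `θ ^ minWell`. The constants do not
depend on `ν`, so the bound survives the limit of vanishing slot length. -/
lemma exists_linear_lower_bound (d : ℕ) (hd : 1 ≤ d) :
    ∃ c : ℝ, 0 < c ∧ ∃ C : ℝ, ∀ (ν : Measure Bool) [IsProbabilityMeasure ν] (n : ℕ),
      c * (ν.real {true} * n) - C ≤ ∫ β, (minWell β n : ℝ) ∂marksLaw d ν := by
  have hd' : (1 : ℝ) ≤ d := by exact_mod_cast hd
  set θ : ℝ := 1 / (4 * d) with hθ
  have h0 : 0 < θ := by positivity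
  have h1 : θ ≤ 1 / 4 := one_div_le_one_div_of_le (by norm_num) (by linarith)
  have h2 : θ * (2 * d) ≤ 1 / 2 := by
    rw [hθ]; field_simp; norm_num
  set S := ∑' x : Site d, θ ^ l1Norm x
  have hS : 0 < S := (summable_zpow_l1Norm h0 (by linarith) d).tsum_pos
    (fun x => by positivity) 0 (by simp)
  have hl : 0 < -Real.log θ := by
    have := Real.log_neg h0 (by linarith)
    linarith
  refine ⟨1 / 4 / -Real.log θ, by positivity, Real.log S / -Real.log θ, fun ν _ n => ?_⟩
  set m := ∫ β, (minWell β n : ℝ) ∂marksLaw d ν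
  have h3 := integral_zpow_minWell_le (d := d) ν h0 h1 h2 n
  -- Jensen by hand: integrate the tangent line of the exponential at the mean.
  have h4 : Real.exp (Real.log θ * m) ≤ ∫ β : Marks d, θ ^ minWell β n ∂marksLaw d ν := by
    have hI : Integrable (fun β : Marks d => Real.exp (Real.log θ * m) *
        (1 + Real.log θ * ((minWell β n : ℝ) - m))) (marksLaw d ν) :=
      ((integrable_const _).add (((integrable_minWell ν n).sub (integrable_const _)).const_mul
        _)).const_mul _
    have hK : Integrable (fun β : Marks d => Real.log θ * ((minWell β n : ℝ) - m))
        (marksLaw d ν) := ((integrable_minWell ν n).sub (integrable_const _)).const_mul _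
    have hJ : Integrable (fun β : Marks d => θ ^ minWell β n) (marksLaw d ν) := by
      refine integrable_of_bounded ((measurable_of_countable (fun k : ℤ => θ ^ k)).comp
        (measurable_minWell n)) 1 fun β => ?_
      rw [abs_of_nonneg (by positivity)]
      simpa using zpow_le_zpow_right_of_le_one₀ h0 (by linarith) (minWell_nonneg β n)
    calc Real.exp (Real.log θ * m) = ∫ β : Marks d, Real.exp (Real.log θ * m) *
          (1 + Real.log θ * ((minWell β n : ℝ) - m)) ∂marksLaw d ν := by
          rw [integral_const_mul, integral_add (integrable_const _) hK, integral_const_mul,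
            integral_sub (integrable_minWell ν n) (integrable_const _)]
          simp [m]
      _ ≤ _ := by
          refine integral_mono hI hJ fun β => ?_
          have h5 : θ ^ minWell β n = Real.exp (Real.log θ * m) *
              Real.exp (Real.log θ * ((minWell β n : ℝ) - m)) := by
            rw [← Real.exp_add, ← mul_add, add_sub_cancel, mul_comm, ← Real.rpow_intCast,
              Real.rpow_def_of_pos h0, mul_comm]
          simp only
          rw [h5]
          refine mul_le_mul_of_nonneg_left ?_ (Real.exp_pos _).le
          rw [add_comm]
          exact Real.add_one_le_exp _
  have h6 := h4.trans h3
  change _ ≤ _ * S at h6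
  rw [← Real.exp_log hS, ← Real.exp_add, Real.exp_le_exp] at h6
  rw [div_mul_eq_mul_div, ← sub_div, div_le_iff₀ hl]
  linarith

/-! ### Existence of the continuous time surface by recursion along rings. -/

/-- The value at the ring `p` depends on the one at the earlier ring `q`, at the same site or at a
nearest neighbour. -/
def DependsOn {d : ℕ} (U : Set (ℝ × Site d)) (q p : ℝ × Site d) : Prop :=
  0 < q.1 ∧ q.1 < p.1 ∧ q ∈ U ∧ p ∈ U ∧ (q.2 = p.2 ∨ ∃ e, q.2 = nbr p.2 e)

/-- The rings at `x` in the time interval `(0, t]`. -/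
def ringsUpTo {d : ℕ} (U : Set (ℝ × Site d)) (x : Site d) (t : ℝ) : Set ℝ :=
  {r | 0 < r ∧ r ≤ t ∧ (r, x) ∈ U}

/-- The rings at `x` in the time interval `(0, t)`. -/
def ringsBefore {d : ℕ} (U : Set (ℝ × Site d)) (x : Site d) (t : ℝ) : Set ℝ :=
  {r | 0 < r ∧ r < t ∧ (r, x) ∈ U}

/-- Clock rings are well behaved if they are locally finite and no ring depends on an infinite
chain of earlier ones. -/
structure Nice {d : ℕ} (U : Set (ℝ × Site d)) : Prop where
  finite_ringsUpTo : ∀ x t, (ringsUpTo U x t).Finite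
  wf : WellFounded (DependsOn U)

/-- The last of a set of times, or `0` if there is none. -/
noncomputable def last (A : Set ℝ) : ℝ := sSup (insert 0 A)

lemma last_mem {A : Set ℝ} (hA : A.Finite) : last A = 0 ∨ last A ∈ A :=
  (Set.insert_nonempty 0 A).csSup_mem (hA.insert 0)

lemma le_last {A : Set ℝ} (hA : A.Finite) {a : ℝ} (ha : a ∈ A) : a ≤ last A :=
  le_csSup (hA.insert 0).bddAbove (Set.mem_insert_of_mem 0 ha)

lemma last_nonneg {A : Set ℝ} (hA : A.Finite) : 0 ≤ last A :=
  le_csSup (hA.insert 0).bddAbove (Set.mem_insert 0 A)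

lemma last_empty : last ∅ = 0 := by simp [last]

section Nice

variable {d : ℕ} {U : Set (ℝ × Site d)}

lemma Nice.finite_ringsBefore (hU : Nice U) (x : Site d) (t : ℝ) : (ringsBefore U x t).Finite :=
  (hU.finite_ringsUpTo x t).subset fun _ hr => ⟨hr.1, hr.2.1.le, hr.2.2⟩

lemma Nice.last_ringsUpTo_le (hU : Nice U) (x : Site d) {t : ℝ} (ht : 0 ≤ t) :
    last (ringsUpTo U x t) ≤ t := by
  rcases last_mem (hU.finite_ringsUpTo x t) with h | h
  · rwa [h]
  · exact h.2.1

lemma Nice.last_ringsBefore_lt (hU : Nice U) (x : Site d) {t : ℝ} (ht : 0 < t) :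
    last (ringsBefore U x t) < t := by
  rcases last_mem (hU.finite_ringsBefore x t) with h | h
  · rwa [h]
  · exact h.2.1

lemma Nice.ringsUpTo_eq_ringsBefore (hU : Nice U) {x : Site d} {s t : ℝ} (hst : s < t)
    (hs : last (ringsBefore U x t) ≤ s) : ringsUpTo U x s = ringsBefore U x t := by
  ext r
  exact ⟨fun h => ⟨h.1, h.2.1.trans_lt hst, h.2.2⟩, fun h =>
    ⟨h.1, (le_last (hU.finite_ringsBefore x t) h).trans hs, h.2.2⟩⟩

lemma Nice.last_ringsUpTo_of_mem (hU : Nice U) {x : Site d} {t : ℝ} (ht : 0 < t)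
    (hx : (t, x) ∈ U) : last (ringsUpTo U x t) = t :=
  le_antisymm (hU.last_ringsUpTo_le x ht.le)
    (le_last (hU.finite_ringsUpTo x t) ⟨ht, le_rfl, hx⟩)

open Classical in
/-- The height right after a ring, by recursion along the dependence relation. -/
noncomputable def ringHeight (hU : Nice U) (H : Site d → ℤ) : ℝ × Site d → ℤ :=
  hU.wf.fix fun p rec => rsosUpdate (fun y =>
    if h : DependsOn U (last (ringsBefore U y p.1), y) p then rec _ h else H y) p.2

open Classical in
lemma ringHeight_eq (hU : Nice U) (H : Site d → ℤ) (p : ℝ × Site d) :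
    ringHeight hU H p = rsosUpdate (fun y =>
      if DependsOn U (last (ringsBefore U y p.1), y) p then
        ringHeight hU H (last (ringsBefore U y p.1), y) else H y) p.2 := by
  rw [ringHeight, WellFounded.fix_eq]
  simp only [dite_eq_ite]

/-- The surface driven by well behaved clock rings. -/
noncomputable def surface (hU : Nice U) (H : Site d → ℤ) (t : ℝ) (x : Site d) : ℤ :=
  if 0 < last (ringsUpTo U x t) then ringHeight hU H (last (ringsUpTo U x t), x) else H x

lemma isRSOS_surface (hU : Nice U) (H : Site d → ℤ) : IsRSOS U H (surface hU H) where
  initial x := by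
    have : ringsUpTo U x 0 = ∅ := by
      ext r
      simp only [ringsUpTo, Set.mem_ofPred_eq, Set.mem_empty_iff_false, iff_false]
      intro h
      linarith [h.1, h.2.1]
    simp [surface, this, last_empty]
  const_between_rings x s t hs hst hr := by
    have : ringsUpTo U x t = ringsUpTo U x s := by
      ext r
      refine ⟨fun h => ⟨h.1, ?_, h.2.2⟩, fun h => ⟨h.1, h.2.1.trans hst, h.2.2⟩⟩
      by_contra hcon
      exact hr r ⟨not_le.1 hcon, h.2.1⟩ h.2.2
    simp only [surface, this]
  update_at_ring x t ht hx := by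
    have hev : ∀ y, ∀ᶠ s in 𝓝[<] t, last (ringsBefore U y t) ≤ s := fun y =>
      mem_of_superset (Ico_mem_nhdsLT (hU.last_ringsBefore_lt y ht)) fun s hs => hs.1
    have hnbr : ∀ᶠ s in 𝓝[<] t, ∀ e, last (ringsBefore U (nbr x e) t) ≤ s :=
      eventually_all.2 fun e => hev _
    filter_upwards [hev x, hnbr, self_mem_nhdsWithin] with s hsx hse hst
    -- At `x` and its neighbours the `DependsOn` test fails only if no ring precedes `t`, and then
    -- the initial height is right. Values at other sites do not enter the update.
    have key : ∀ y, (y = x ∨ ∃ e, y = nbr x e) → last (ringsBefore U y t) ≤ s →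
        (open Classical in if DependsOn U (last (ringsBefore U y t), y) (t, x) then
          ringHeight hU H (last (ringsBefore U y t), y) else H y) = surface hU H s y := by
      intro y hy hs
      simp only [surface, hU.ringsUpTo_eq_ringsBefore hst hs]
      congr 1
      refine propext ⟨fun h => h.1, fun h => ?_⟩
      rcases last_mem (hU.finite_ringsBefore y t) with h0 | h0
      · exact absurd h (by rw [h0]; exact lt_irrefl _)
      · exact ⟨h, h0.2.1, h0.2.2, hx, hy⟩
    have h1 : surface hU H t x = ringHeight hU H (t, x) := by
      simp only [surface, hU.last_ringsUpTo_of_mem ht hx, ht, if_true]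
    rw [h1, ringHeight_eq]
    exact rsosUpdate_congr (key x (Or.inl rfl) hsx) fun e => key _ (Or.inr ⟨e, rfl⟩) (hse e)

lemma _root_.IsRSOS.eq_last {H : Site d → ℤ} {g : ℝ → Site d → ℤ} (hg : IsRSOS U H g) (hU : Nice U)
    {t : ℝ} (ht : 0 ≤ t) (x : Site d) : g t x = g (last (ringsUpTo U x t)) x := by
  refine hg.const_between_rings x _ t (last_nonneg (hU.finite_ringsUpTo x t))
    (hU.last_ringsUpTo_le x ht) fun r hr hrU => ?_
  have := le_last (hU.finite_ringsUpTo x t)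
    ⟨(last_nonneg (hU.finite_ringsUpTo x t)).trans_lt hr.1, hr.2, hrU⟩
  linarith [hr.1]

end Nice

/-! ### Convergence of the discretisations, and uniqueness. -/

/-- The `j`-th time slot of length `2 ^ (-m)`. -/
def slot (m j : ℕ) : Set ℝ := Set.Ioc ((j : ℝ) / 2 ^ m) (((j : ℝ) + 1) / 2 ^ m)

open Classical in
/-- The marks that tell which clocks ring in which time slots of length `2 ^ (-m)`. -/
noncomputable def marks {d : ℕ} (U : Set (ℝ × Site d)) (m : ℕ) : Marks d :=
  fun p => decide (∃ r ∈ slot m p.1, (r, p.2) ∈ U)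

lemma evol_eq_of_no_mark {d : ℕ} {β : Marks d} (H : Site d → ℤ) {x : Site d} {a b : ℕ}
    (hab : a ≤ b) (h : ∀ j, a ≤ j → j < b → β (j, x) = false) :
    evol β H b x = evol β H a x := by
  induction b, hab using Nat.le_induction with
  | base => rfl
  | succ b hb ih =>
    rw [← ih fun j hj hjb => h j hj (by omega)]
    simp [evol, DualRSOS.step, h b hb (by omega)]

section Nice

variable {d : ℕ} {U : Set (ℝ × Site d)} {H : Site d → ℤ} {g : ℝ → Site d → ℤ}

lemma tendsto_const_mul_two_pow {c : ℝ} (hc : 0 < c) :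
    Tendsto (fun m : ℕ => c * 2 ^ m) atTop atTop :=
  (tendsto_pow_atTop_atTop_of_one_lt (by norm_num : (1 : ℝ) < 2)).const_mul_atTop hc

lemma marks_eq_false {m j : ℕ} {x : Site d} (h : ∀ r ∈ slot m j, (r, x) ∉ U) :
    marks U m (j, x) = false := by
  simp only [marks, decide_eq_false_iff_not, not_exists, not_and]
  exact h

/-- Induction along the dependence relation. For fine slots, the previous rings at the site and at
its neighbours fall in earlier slots than `p`, so the parallel update reads the true left limits.
The solution `g` is arbitrary, which is what gives uniqueness. -/
lemma _root_.IsRSOS.eventually_evol_eq_of_mem (hg : IsRSOS U H g) (hU : Nice U) (p : ℝ × Site d) :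
    0 < p.1 → p ∈ U → ∀ᶠ m : ℕ in atTop, evol (marks U m) H ⌈p.1 * 2 ^ m⌉₊ p.2 = g p.1 p.2 := by
  induction p using hU.wf.induction with
  | _ p ih =>
  obtain ⟨t, x⟩ := p
  simp only at ih ⊢
  intro ht hx
  have key : ∀ y, (y = x ∨ ∃ e, y = nbr x e) → (∀ᶠ m : ℕ in atTop, ∀ᶠ s in 𝓝[<] t,
      evol (marks U m) H (⌈t * 2 ^ m⌉₊ - 1) y = g s y) := by
    intro y hy
    set r := last (ringsBefore U y t) with hr
    have hrt : r < t := hU.last_ringsBefore_lt y ht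
    have hr0 : 0 ≤ r := last_nonneg (hU.finite_ringsBefore y t)
    have h1 : ∀ᶠ m : ℕ in atTop, evol (marks U m) H ⌈r * 2 ^ m⌉₊ y = g r y := by
      rcases last_mem (hU.finite_ringsBefore y t) with h0 | h0
      · rw [← hr] at h0
        simp [h0, evol, hg.initial]
      · exact ih (r, y) ⟨h0.1, h0.2.1, h0.2.2, hx, hy⟩ h0.1 h0.2.2
    have hno : ∀ r' ∈ Set.Ioo r t, (r', y) ∉ U := fun r' hr' hmem => by
      have := le_last (hU.finite_ringsBefore y t) ⟨hr0.trans_lt hr'.1, hr'.2, hmem⟩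
      linarith [hr'.1]
    -- This separation forces the ceilings of `r * 2 ^ m` and `t * 2 ^ m` to differ. The ring at `t`
    -- lies in slot `⌈t * 2 ^ m⌉₊ - 1`, and the surface before that slot has already absorbed the
    -- ring at `r`.
    have h2 : ∀ᶠ m : ℕ in atTop, 2 ≤ (t - r) * 2 ^ m :=
      (tendsto_const_mul_two_pow (sub_pos.2 hrt)).eventually_ge_atTop 2
    filter_upwards [h1, h2] with m hm1 hm2
    have hpow : (0 : ℝ) < 2 ^ m := by positivity
    have hceil := Nat.ceil_lt_add_one (mul_nonneg ht.le hpow.le)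
    have hceil' := Nat.ceil_lt_add_one (mul_nonneg hr0 hpow.le)
    have hle : ⌈r * 2 ^ m⌉₊ ≤ ⌈t * 2 ^ m⌉₊ - 1 := by
      have h3 := Nat.le_ceil (t * 2 ^ m)
      have h4 : (⌈r * 2 ^ m⌉₊ : ℝ) < ⌈t * 2 ^ m⌉₊ := by nlinarith
      have h5 : ⌈r * 2 ^ m⌉₊ < ⌈t * 2 ^ m⌉₊ := by exact_mod_cast h4
      omega
    rw [evol_eq_of_no_mark H hle, hm1]
    · filter_upwards [Ico_mem_nhdsLT hrt] with s hs
      exact (hg.const_between_rings y r s hr0 hs.1 fun r' hr' =>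
        hno r' ⟨hr'.1, hr'.2.trans_lt hs.2⟩).symm
    · intro j hj hjt
      refine marks_eq_false fun r' hr' => hno r' ⟨?_, ?_⟩
      · refine lt_of_le_of_lt ?_ hr'.1
        rw [le_div_iff₀ hpow]
        exact (Nat.le_ceil _).trans (by exact_mod_cast hj)
      · refine hr'.2.trans_lt ?_
        rw [div_lt_iff₀ hpow]
        have : ((j + 1 + 1 : ℕ) : ℝ) ≤ ⌈t * 2 ^ m⌉₊ := Nat.cast_le.2 (by omega)
        push_cast at this
        linarith
  have hall : ∀ᶠ m : ℕ in atTop, ∀ e, ∀ᶠ s in 𝓝[<] t,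
      evol (marks U m) H (⌈t * 2 ^ m⌉₊ - 1) (nbr x e) = g s (nbr x e) :=
    eventually_all.2 fun e => key _ (Or.inr ⟨e, rfl⟩)
  filter_upwards [key x (Or.inl rfl), hall] with m hm1 hm2
  have hpow : (0 : ℝ) < 2 ^ m := by positivity
  obtain ⟨s, hs1, hs2, hs3⟩ := (hm1.and ((eventually_all.2 hm2).and
    (hg.update_at_ring x t ht hx))).exists
  have hceil := Nat.ceil_lt_add_one (mul_nonneg ht.le hpow.le)
  obtain ⟨k, hk⟩ : ∃ k, ⌈t * 2 ^ m⌉₊ = k + 1 :=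
    Nat.exists_eq_succ_of_ne_zero (Nat.ceil_pos.2 (mul_pos ht hpow)).ne'
  rw [hk, Nat.add_sub_cancel] at hs1 hs2
  have hmark : marks U m (k, x) = true := by
    simp only [marks, decide_eq_true_eq]
    refine ⟨t, ⟨?_, ?_⟩, hx⟩
    · rw [div_lt_iff₀ hpow]
      rw [hk] at hceil
      push_cast at hceil
      linarith
    · rw [le_div_iff₀ hpow]
      have := Nat.le_ceil (t * 2 ^ m)
      rw [hk] at this
      exact_mod_cast this
  rw [hk, hs3]
  simp only [evol, DualRSOS.step, hmark, if_true]
  exact rsosUpdate_congr hs1 hs2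

lemma _root_.IsRSOS.eventually_evol_eq_last (hg : IsRSOS U H g) (hU : Nice U) (t : ℝ) (x : Site d) :
    ∀ᶠ m : ℕ in atTop, evol (marks U m) H ⌈last (ringsUpTo U x t) * 2 ^ m⌉₊ x =
      g (last (ringsUpTo U x t)) x := by
  rcases last_mem (hU.finite_ringsUpTo x t) with h0 | h0
  · simp [h0, evol, hg.initial]
  · exact hg.eventually_evol_eq_of_mem hU _ h0.1 h0.2.2

/-- For fine slots both solutions agree with the same discrete evolution, which does not involve `g`
or `g'`. -/
lemma _root_.IsRSOS.eq_of_nice (hg : IsRSOS U H g) {g' : ℝ → Site d → ℤ} (hg' : IsRSOS U H g')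
    (hU : Nice U) {t : ℝ} (ht : 0 ≤ t) (x : Site d) : g t x = g' t x := by
  rw [hg.eq_last hU ht, hg'.eq_last hU ht]
  obtain ⟨m, h1, h2⟩ := ((hg.eventually_evol_eq_last hU t x).and
    (hg'.eventually_evol_eq_last hU t x)).exists
  rw [← h1, ← h2]

lemma _root_.IsRSOS.mono (hg : IsRSOS U H g) (hU : Nice U) {s t : ℝ} (hs : 0 ≤ s) (hst : s ≤ t)
    (x : Site d) : g s x ≤ g t x := by
  rw [hg.eq_last hU hs, hg.eq_last hU (hs.trans hst)]
  obtain ⟨m, h1, h2⟩ := ((hg.eventually_evol_eq_last hU s x).and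
    (hg.eventually_evol_eq_last hU t x)).exists
  rw [← h1, ← h2]
  refine evol_mono_time _ _ _ (Nat.ceil_mono (mul_le_mul_of_nonneg_right ?_ (by positivity)))
  refine csSup_le_csSup ((hU.finite_ringsUpTo x t).insert 0).bddAbove (Set.insert_nonempty _ _)
    (Set.insert_subset_insert fun r hr => ⟨hr.1, hr.2.1.trans hst, hr.2.2⟩)

lemma _root_.IsRSOS.eventually_evol_eq (hg : IsRSOS U H g) (hU : Nice U) (n : ℕ) (x : Site d) :
    ∀ᶠ m : ℕ in atTop, evol (marks U m) H (n * 2 ^ m) x = g n x := by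
  filter_upwards [hg.eventually_evol_eq_last hU n x] with m hm
  have hpow : (0 : ℝ) < 2 ^ m := by positivity
  rw [hg.eq_last hU (Nat.cast_nonneg n), ← hm]
  have hle := hU.last_ringsUpTo_le x (Nat.cast_nonneg n)
  refine evol_eq_of_no_mark H ?_ fun j hj hjn => marks_eq_false fun r hr hmem => ?_
  · refine Nat.ceil_le.2 ?_
    push_cast
    exact mul_le_mul_of_nonneg_right hle hpow.le
  · have h1 : last (ringsUpTo U x n) ≤ j / 2 ^ m := by
      rw [le_div_iff₀ hpow]
      exact (Nat.le_ceil _).trans (by exact_mod_cast hj)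
    have h2 : r ≤ n := by
      refine hr.2.trans ?_
      rw [div_le_iff₀ hpow]
      exact_mod_cast hjn
    have := le_last (hU.finite_ringsUpTo x n)
      ⟨(last_nonneg (hU.finite_ringsUpTo x n)).trans_lt (h1.trans_lt hr.1), h2, hmem⟩
    linarith [hr.1]

lemma l1Norm_le_of_isDualRSOS (hg : IsDualRSOS U g) (hU : Nice U) {t : ℝ} (ht : 0 ≤ t)
    (x : Site d) : l1Norm x ≤ g t x := by
  have := IsRSOS.mono hg hU le_rfl ht x
  rwa [hg.initial] at this

lemma minHeight_mono (hg : IsDualRSOS U g) (hU : Nice U) {s t : ℝ} (hs : 0 ≤ s) (hst : s ≤ t) :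
    minHeight g s ≤ minHeight g t :=
  ciInf_mono ⟨0, by
    rintro _ ⟨x, rfl⟩
    exact (l1Norm_nonneg x).trans (l1Norm_le_of_isDualRSOS hg hU hs x)⟩
    fun x => IsRSOS.mono hg hU hs hst x

lemma minHeight_nonneg (hg : IsDualRSOS U g) (hU : Nice U) {t : ℝ} (ht : 0 ≤ t) :
    0 ≤ minHeight g t :=
  le_ciInf fun x => (l1Norm_nonneg x).trans (l1Norm_le_of_isDualRSOS hg hU ht x)

lemma eventually_minWell_eq (hg : IsDualRSOS U g) (hU : Nice U) (n : ℕ) :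
    ∀ᶠ m : ℕ in atTop, minWell (marks U m) (n * 2 ^ m) = minHeight g n := by
  have hn : (0 : ℝ) ≤ n := Nat.cast_nonneg n
  have hg0 : ∀ x, 0 ≤ g n x := fun x =>
    (l1Norm_nonneg x).trans (l1Norm_le_of_isDualRSOS hg hU hn x)
  -- Both surfaces stay above the initial well, so once they agree at the origin all their
  -- minimisers lie in this finite set; convergence there suffices.
  have hfin : ∀ᶠ m : ℕ in atTop, ∀ x ∈ {x : Site d | l1Norm x ≤ g n 0},
      well (marks U m) (n * 2 ^ m) x = g n x :=
    (finite_l1Norm_le (g n 0)).eventually_all.2 fun x _ => IsRSOS.eventually_evol_eq hg hU n x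
  filter_upwards [hfin] with m hm
  have h0 : well (marks U m) (n * 2 ^ m) 0 = g n 0 := hm 0 (by
    simpa using hg0 0)
  obtain ⟨x, hx⟩ := exists_eq_iInf hg0
  obtain ⟨y, hy⟩ := exists_eq_iInf (well_nonneg (marks U m) (n * 2 ^ m))
  have hx0 : l1Norm x ≤ g n 0 :=
    (l1Norm_le_of_isDualRSOS hg hU hn x).trans (hx ▸ iInf_le_apply hg0 0)
  have hy0 : l1Norm y ≤ g n 0 := by
    refine (l1Norm_le_well (marks U m) (n * 2 ^ m) y).trans ?_
    rw [hy, ← h0]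
    exact minWell_le _ _ 0
  refine le_antisymm ?_ ?_
  · rw [minHeight, ← hx, ← hm x hx0]
    exact minWell_le _ _ x
  · rw [minWell, ← hy, hm y hy0]
    exact iInf_le_apply hg0 y

end Nice

/-! ### Finite clusters of ringing sites in a slot. -/

section Percolation

variable {d : ℕ}

/-- The end of the lattice walk from `x` with the given steps, the last step first. -/
def walkEnd (x : Site d) : List (Fin d × Bool) → Site d
  | [] => x
  | e :: l => nbr (walkEnd x l) e

/-- The sites visited by the lattice walk from `x` with the given steps, the last step first. -/
def walkSites (x : Site d) : List (Fin d × Bool) → List (Site d)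
  | [] => [x]
  | e :: l => walkEnd x (e :: l) :: walkSites x l

lemma length_walkSites (x : Site d) (l : List (Fin d × Bool)) :
    (walkSites x l).length = l.length + 1 := by
  induction l with
  | nil => rfl
  | cons e l ih => simp [walkSites, ih]

/-- A self-avoiding walk through marked sites. -/
def OpenWalk (b : Site d → Bool) (x : Site d) (l : List (Fin d × Bool)) : Prop :=
  (walkSites x l).Nodup ∧ ∀ z ∈ walkSites x l, b z = true

lemma OpenWalk.of_cons {b : Site d → Bool} {x : Site d} {e : Fin d × Bool}
    {l : List (Fin d × Bool)} (h : OpenWalk b x (e :: l)) : OpenWalk b x l :=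
  ⟨(List.nodup_cons.1 h.1).2, fun z hz => h.2 z (List.mem_cons_of_mem _ hz)⟩

lemma OpenWalk.drop {b : Site d → Bool} {x : Site d} {l : List (Fin d × Bool)}
    (h : OpenWalk b x l) (k : ℕ) : OpenWalk b x (l.drop k) := by
  induction k generalizing l with
  | zero => simpa
  | succ k ih =>
    cases l with
    | nil => simpa
    | cons e l => exact ih h.of_cons

lemma OpenWalk.exists_walkEnd_eq {b : Site d → Bool} {x z : Site d} {l : List (Fin d × Bool)}
    (h : OpenWalk b x l) (hz : z ∈ walkSites x l) : ∃ l', OpenWalk b x l' ∧ walkEnd x l' = z := by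
  induction l with
  | nil => exact ⟨[], h, (List.mem_singleton.1 hz).symm⟩
  | cons e l ih =>
    rcases List.mem_cons.1 hz with rfl | hz
    · exact ⟨_, h, rfl⟩
    · exact ih h.of_cons hz

/-- If self-avoiding walks through marked sites have bounded length, each site belongs to a finite
set that contains the neighbours of its marked sites. -/
lemma exists_finite_closed {b : Site d → Bool} {x : Site d} {n : ℕ}
    (hn : ∀ l : List (Fin d × Bool), l.length = n → ¬ OpenWalk b x l) :
    ∃ S : Set (Site d), S.Finite ∧ x ∈ S ∧ ∀ y ∈ S, b y = true → ∀ e, nbr y e ∈ S := by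
  set C := walkEnd x '' {l | OpenWalk b x l} with hC
  have hCfin : C.Finite := by
    refine ((List.finite_length_lt (Fin d × Bool) n).subset fun l hl => ?_).image _
    by_contra hlen
    simp only [Set.mem_ofPred_eq, not_lt] at hlen
    exact hn (l.drop (l.length - n)) (by rw [List.length_drop]; omega) (OpenWalk.drop hl _)
  have hclosed : ∀ y ∈ C, ∀ e, b (nbr y e) = true → nbr y e ∈ C := by
    rintro _ ⟨l, hl, rfl⟩ e he
    -- If the new site was already visited, cut the walk there instead of extending it.
    by_cases hmem : nbr (walkEnd x l) e ∈ walkSites x l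
    · obtain ⟨l', hl', hl'e⟩ := OpenWalk.exists_walkEnd_eq hl hmem
      exact ⟨l', hl', hl'e⟩
    · refine ⟨e :: l, ⟨List.nodup_cons.2 ⟨hmem, hl.1⟩, fun z hz => ?_⟩, rfl⟩
      rcases List.mem_cons.1 hz with rfl | hz
      · exact he
      · exact hl.2 z hz
  -- The cluster together with its neighbours; `x` is added separately because it may be unmarked,
  -- and then the cluster is empty.
  refine ⟨insert x (C ∪ ⋃ e, (fun y => nbr y e) '' C), ?_, Set.mem_insert _ _, ?_⟩
  · exact (hCfin.union (Set.finite_iUnion fun e => hCfin.image _)).insert x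
  · have key : ∀ y ∈ C, ∀ e, nbr y e ∈ insert x (C ∪ ⋃ e, (fun y => nbr y e) '' C) :=
      fun y hy e => Or.inr (Or.inr (Set.mem_iUnion.2 ⟨e, y, hy, rfl⟩))
    rintro y (rfl | hy | hy) hby e
    · refine key _ ⟨[], ⟨List.nodup_singleton _, fun z hz => ?_⟩, rfl⟩ e
      rwa [List.mem_singleton.1 hz]
    · exact key y hy e
    · obtain ⟨e', y', hy', rfl⟩ := Set.mem_iUnion.1 hy
      exact key _ (hclosed y' hy' e' hby) e

lemma marksLaw_openWalk_le (ν : Measure Bool) [IsProbabilityMeasure ν] (j : ℕ) (x : Site d)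
    (l : List (Fin d × Bool)) :
    marksLaw d ν {β | OpenWalk (fun z => β (j, z)) x l} ≤ ν {true} ^ (l.length + 1) := by
  classical
  by_cases hnd : (walkSites x l).Nodup
  · have h1 := Measure.infinitePi_pi (fun _ : ℕ × Site d => ν)
      (s := (walkSites x l).toFinset.image fun z => (j, z)) (t := fun _ => {true})
      (fun _ _ => MeasurableSet.of_discrete)
    rw [Finset.prod_const, Finset.card_image_of_injective _ (Prod.mk_right_injective j),
      List.toFinset_card_of_nodup hnd, length_walkSites] at h1
    rw [← h1]
    refine measure_mono fun β hβ => ?_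
    simpa [Set.mem_pi] using hβ.2
  · refine le_of_eq_of_le (measure_mono_null (t := ∅) (fun β hβ => hnd hβ.1) measure_empty)
      zero_le

/-- First moment bound: `(2 * d) ^ n` walks of length `n`, each open with probability at most `ν
{true} ^ n`. -/
lemma ae_exists_no_openWalk (ν : Measure Bool) [IsProbabilityMeasure ν]
    (hν : 2 * d * ν {true} < 1) :
    ∀ᵐ β ∂marksLaw d ν, ∀ (j : ℕ) (x : Site d), ∃ n, ∀ l : List (Fin d × Bool), l.length = n →
      ¬ OpenWalk (fun z => β (j, z)) x l := by
  refine ae_all_iff.2 fun j => ae_all_iff.2 fun x => ?_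
  rw [ae_iff]
  refine le_antisymm (ge_of_tendsto' (ENNReal.tendsto_pow_atTop_nhds_zero_of_lt_one hν) ?_)
    zero_le
  intro n
  calc marksLaw d ν {β | ¬ ∃ n, ∀ l : List (Fin d × Bool), l.length = n →
        ¬ OpenWalk (fun z => β (j, z)) x l}
      ≤ marksLaw d ν (⋃ l : List.Vector (Fin d × Bool) n,
          {β | OpenWalk (fun z => β (j, z)) x l.1}) := by
        refine measure_mono fun β hβ => ?_
        simp only [Set.mem_ofPred_eq, not_exists, not_forall, not_not] at hβ
        obtain ⟨l, hl, hl'⟩ := hβ n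
        exact Set.mem_iUnion.2 ⟨⟨l, hl⟩, hl'⟩
    _ ≤ ∑ l : List.Vector (Fin d × Bool) n, marksLaw d ν {β | OpenWalk (fun z => β (j, z)) x l.1} :=
        measure_iUnion_fintype_le _ _
    _ ≤ ∑ l : List.Vector (Fin d × Bool) n, ν {true} ^ n := by
        refine Finset.sum_le_sum fun l _ => (marksLaw_openWalk_le ν j x l.1).trans ?_
        rw [l.2]
        exact pow_le_pow_right_of_le_one' prob_le_one (Nat.le_succ n)
    _ = (2 * d * ν {true}) ^ n := by
        rw [Finset.sum_const, Finset.card_univ, card_vector, Fintype.card_prod, Fintype.card_fin,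
          Fintype.card_bool, nsmul_eq_mul]
        push_cast
        rw [← mul_pow, mul_comm (d : ENNReal)]

end Percolation

/-! ### Poisson clocks: law of the marks and well-foundedness. -/

/-- The law of the mark of a time slot of length `2 ^ (-m)`. -/
noncomputable def slotLaw (m : ℕ) : Measure Bool :=
  (poissonMeasure ((1 / 2) ^ m)).map fun k => decide (k ≠ 0)

instance (m : ℕ) : IsProbabilityMeasure (slotLaw m) :=
  Measure.isProbabilityMeasure_map .of_discrete

lemma slotLaw_real (m : ℕ) : (slotLaw m).real {true} = 1 - Real.exp (-(1 / 2) ^ m) := by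
  have h1 : (slotLaw m).real {true} = (poissonMeasure ((1 / 2) ^ m)).real {0}ᶜ := by
    rw [slotLaw, map_measureReal_apply .of_discrete (measurableSet_singleton true)]
    congr 1
    ext k
    simp
  rw [h1, probReal_compl_eq_one_sub (measurableSet_singleton 0), poissonMeasure_real_singleton]
  simp

lemma slotLaw_real_le (m : ℕ) : (slotLaw m).real {true} ≤ (1 / 2) ^ m := by
  rw [slotLaw_real]
  have := Real.add_one_le_exp (-(1 / 2 : ℝ) ^ m)
  linarith

lemma le_slotLaw_real (m : ℕ) : (1 / 2) ^ m / 2 ≤ (slotLaw m).real {true} := by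
  rw [slotLaw_real]
  set r : ℝ := (1 / 2) ^ m
  have hr0 : 0 < r := by positivity
  have hr1 : r ≤ 1 := pow_le_one₀ (by norm_num) (by norm_num)
  have h1 := Real.add_one_le_exp r
  have h2 : Real.exp (-r) * Real.exp r = 1 := by rw [← Real.exp_add]; simp
  have h3 := Real.exp_pos (-r)
  nlinarith

/-- With slots of length `2 ^ (-(d + 1))` the left side is at most `d / 2 ^ d`. -/
lemma slotLaw_subcritical (d : ℕ) : 2 * d * slotLaw (d + 1) {true} < 1 := by
  have h1 : slotLaw (d + 1) {true} ≤ ENNReal.ofReal ((1 / 2) ^ (d + 1)) := by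
    rw [← ofReal_measureReal]
    exact ENNReal.ofReal_le_ofReal (slotLaw_real_le _)
  refine (mul_le_mul_right h1 _).trans_lt ?_
  have h2 : (2 * d : ENNReal) = ENNReal.ofReal (2 * d) := by
    rw [ENNReal.ofReal_mul (by norm_num)]; simp
  rw [h2, ← ENNReal.ofReal_mul (by positivity), ENNReal.ofReal_lt_one, pow_succ, one_div, inv_pow]
  have h3 : (d : ℝ) < 2 ^ d := by exact_mod_cast Nat.lt_two_pow_self
  have h4 : (0 : ℝ) < 2 ^ d := by positivity
  have : 2 * (d : ℝ) * ((2 ^ d)⁻¹ * 2⁻¹) = d / 2 ^ d := by field_simp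
  rw [this, div_lt_one h4]
  exact h3

lemma marks_eq_count {d : ℕ} (U : Set (ℝ × Site d)) (m : ℕ) (p : ℕ × Site d) :
    marks U m p = decide ((U ∩ slot m p.1 ×ˢ {p.2}).encard ≠ 0) := by
  simp only [marks, decide_eq_decide, Set.encard_ne_zero]
  constructor
  · rintro ⟨r, hr, hmem⟩
    exact ⟨(r, p.2), hmem, hr, rfl⟩
  · rintro ⟨⟨r, y⟩, hmem, hr, hy⟩
    obtain rfl : y = p.2 := hy
    exact ⟨r, hr, hmem⟩

section Poisson

variable {d : ℕ} {Ω : Type*} [MeasurableSpace Ω] {P : Measure Ω}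
  {U : Ω → Set (ℝ × Site d)}

lemma clockIntensity_Ioc (x : Site d) {a b : ℝ} (ha : 0 ≤ a) :
    clockIntensity d (Set.Ioc a b ×ˢ {x}) = ((b - a).toNNReal : ENNReal) := by
  rw [clockIntensity, Measure.prod_prod, Measure.count_singleton, mul_one,
    Measure.restrict_apply measurableSet_Ioc, Set.inter_eq_left.2 fun r (hr : r ∈ Set.Ioc a b) => Set.mem_Ioi.2 (ha.trans_lt hr.1),
    Real.volume_Ioc]
  rfl

lemma map_count_Ioc (hU : IsPoissonPointProcess U (clockIntensity d) P) (x : Site d) {a b : ℝ}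
    (ha : 0 ≤ a) :
    P.map (fun ω => (U ω ∩ Set.Ioc a b ×ˢ {x}).encard) =
      (poissonMeasure (b - a).toNNReal).map (fun k : ℕ => (k : ℕ∞)) :=
  hU.law_count _ _ (measurableSet_Ioc.prod (measurableSet_singleton x)) (clockIntensity_Ioc x ha)

lemma iIndepFun_count (hU : IsPoissonPointProcess U (clockIntensity d) P) {ι : Type*}
    (B : ι → Set (ℝ × Site d)) (hB : ∀ i, MeasurableSet (B i))
    (hd : Pairwise fun i j => Disjoint (B i) (B j)) :
    iIndepFun (fun i ω => (U ω ∩ B i).encard) P := by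
  refine iIndepFun_iff_finset.2 fun s => ?_
  refine (iIndepFun_precomp_of_bijective s.equivFin.symm.bijective).1 ?_
  exact hU.indep_count _ (fun i => B (s.equivFin.symm i)) (fun i => hB _) fun i j hij =>
    hd fun h => hij (s.equivFin.symm.injective (Subtype.ext h))

lemma ae_finite_ringsUpTo (hU : IsPoissonPointProcess U (clockIntensity d) P) :
    ∀ᵐ ω ∂P, ∀ x t, (ringsUpTo (U ω) x t).Finite := by
  have h1 : ∀ᵐ ω ∂P, ∀ (x : Site d) (n : ℕ),
      (U ω ∩ Set.Ioc (0 : ℝ) n ×ˢ {x}).encard ≠ ⊤ := by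
    refine ae_all_iff.2 fun x => ae_all_iff.2 fun n => ?_
    have hm := hU.measurable_count (Set.Ioc (0 : ℝ) n ×ˢ {x})
      (measurableSet_Ioc.prod (measurableSet_singleton x))
    have h2 := congrArg (fun μ => μ {⊤}) (map_count_Ioc hU x (b := n) le_rfl)
    rw [Measure.map_apply hm (measurableSet_singleton _),
      Measure.map_apply .of_discrete (measurableSet_singleton _)] at h2
    rw [ae_iff]
    simp only [not_not]
    refine h2.trans ?_
    convert measure_empty (μ := poissonMeasure ((n : ℝ) - 0).toNNReal) using 2
    ext k
    simp
  filter_upwards [h1] with ω hω x t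
  obtain ⟨n, hn⟩ := exists_nat_ge t
  have h3 := Set.encard_ne_top_iff.1 (hω x n)
  refine (h3.image Prod.fst).subset fun r hr => ⟨(r, x), ⟨hr.2.2, ⟨hr.1, hr.2.1.trans hn⟩, rfl⟩, rfl⟩

lemma slot_disjoint {m j k : ℕ} (hjk : j ≠ k) : Disjoint (slot m j) (slot m k) := by
  wlog h : j < k generalizing j k
  · exact (this hjk.symm (by omega)).symm
  refine Set.disjoint_left.2 fun r hr hr' => ?_
  have h1 : ((j : ℝ) + 1) / 2 ^ m ≤ k / 2 ^ m :=
    div_le_div_of_nonneg_right (by exact_mod_cast h) (by positivity)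
  exact absurd (hr.2.trans h1) (not_le.2 hr'.1)

lemma measurable_marks (hU : IsPoissonPointProcess U (clockIntensity d) P) (m : ℕ)
    (p : ℕ × Site d) : Measurable fun ω => marks (U ω) m p := by
  simp only [marks_eq_count]
  exact (measurable_of_countable (fun k : ℕ∞ => decide (k ≠ 0))).comp (hU.measurable_count _
    (measurableSet_Ioc.prod (measurableSet_singleton _)))

lemma map_marks_apply (hU : IsPoissonPointProcess U (clockIntensity d) P) (m : ℕ)
    (p : ℕ × Site d) : P.map (fun ω => marks (U ω) m p) = slotLaw m := by
  have hm := hU.measurable_count (slot m p.1 ×ˢ {p.2})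
    (measurableSet_Ioc.prod (measurableSet_singleton _))
  have hlen : (((p.1 : ℝ) + 1) / 2 ^ m - p.1 / 2 ^ m).toNNReal = (1 / 2) ^ m := by
    rw [← sub_div, add_sub_cancel_left, ← one_div_pow,
      Real.toNNReal_pow (by norm_num), Real.toNNReal_div (by norm_num)]
    simp
  have hlaw := map_count_Ioc hU p.2 (a := (p.1 : ℝ) / 2 ^ m) (b := ((p.1 : ℝ) + 1) / 2 ^ m)
    (by positivity)
  rw [hlen] at hlaw
  simp only [marks_eq_count]
  change P.map ((fun k : ℕ∞ => decide (k ≠ 0)) ∘ _) = _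
  rw [← Measure.map_map (measurable_of_countable _) hm]
  unfold slot
  rw [hlaw, Measure.map_map (measurable_of_countable _) .of_discrete, slotLaw]
  congr 1
  ext k
  simp

lemma map_marks (hU : IsPoissonPointProcess U (clockIntensity d) P) (m : ℕ) :
    P.map (fun ω => marks (U ω) m) = marksLaw d (slotLaw m) := by
  have h1 : iIndepFun (fun (p : ℕ × Site d) ω => (U ω ∩ slot m p.1 ×ˢ {p.2}).encard) P := by
    refine iIndepFun_count hU _ (fun p => measurableSet_Ioc.prod (measurableSet_singleton _)) ?_
    rintro ⟨j, x⟩ ⟨k, y⟩ hne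
    rw [Set.disjoint_prod]
    by_cases hjk : j = k
    · refine Or.inr (Set.disjoint_singleton.2 fun hxy => hne ?_)
      simp only at hxy
      rw [hjk, hxy]
    · exact Or.inl (slot_disjoint hjk)
  have h2 : iIndepFun (fun (p : ℕ × Site d) ω => marks (U ω) m p) P := by
    simp only [marks_eq_count]
    exact h1.comp (fun _ k => decide (k ≠ 0)) fun _ => measurable_of_countable _
  have h3 := h2.map_fun_eq_infinitePi_map (measurable_marks hU m)
  simp only [map_marks_apply hU] at h3
  exact h3

lemma measurable_marks' (hU : IsPoissonPointProcess U (clockIntensity d) P) (m : ℕ) :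
    Measurable fun ω => marks (U ω) m :=
  measurable_pi_iff.2 (measurable_marks hU m)

end Poisson

lemma acc_dependsOn_of_nonpos {d : ℕ} {U : Set (ℝ × Site d)} {p : ℝ × Site d} (hp : p.1 ≤ 0) :
    Acc (DependsOn U) p :=
  ⟨p, fun _ hq => absurd (hq.1.trans hq.2.1) (not_lt.2 hp)⟩

/-- Induction on slots. Inside a slot, a backward chain from `x` cannot leave the finite set `S`, on
which there are finitely many ring times; since times strictly decrease, the chain soon reaches an
earlier slot. -/
lemma wellFounded_dependsOn {d : ℕ} {U : Set (ℝ × Site d)} {m : ℕ}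
    (hfin : ∀ x t, (ringsUpTo U x t).Finite)
    (hS : ∀ (j : ℕ) (x : Site d), ∃ S : Set (Site d), S.Finite ∧ x ∈ S ∧
      ∀ y ∈ S, marks U m (j, y) = true → ∀ e, nbr y e ∈ S) :
    WellFounded (DependsOn U) := by
  have hpow : (0 : ℝ) < 2 ^ m := by positivity
  have key : ∀ (j : ℕ) (p : ℝ × Site d), p.1 ≤ j / 2 ^ m → Acc (DependsOn U) p := by
    intro j
    induction j with
    | zero => exact fun p hp => acc_dependsOn_of_nonpos (by simpa using hp)
    | succ j ih =>
      rintro ⟨t, x⟩ ht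
      by_cases htj : t ≤ j / 2 ^ m
      · exact ih _ htj
      by_cases hx : (t, x) ∈ U
      swap
      · exact ⟨_, fun _ hq => absurd hq.2.2.2.1 hx⟩
      obtain ⟨S, hSfin, hxS, hSc⟩ := hS j x
      have hA : {r | r ∈ slot m j ∧ ∃ y ∈ S, (r, y) ∈ U}.Finite := by
        refine (hSfin.biUnion fun y _ => hfin y (((j : ℝ) + 1) / 2 ^ m)).subset ?_
        rintro r ⟨hr, y, hy, hry⟩
        have h0 : (0 : ℝ) ≤ j / 2 ^ m := by positivity
        exact Set.mem_biUnion hy ⟨h0.trans_lt hr.1, hr.2, hry⟩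
      have hwf : {r | r ∈ slot m j ∧ ∃ y ∈ S, (r, y) ∈ U}.WellFoundedOn (· < ·) :=
        hA.wellFoundedOn
      have htA : t ∈ {r | r ∈ slot m j ∧ ∃ y ∈ S, (r, y) ∈ U} :=
        ⟨⟨not_le.1 htj, by push_cast at ht; exact ht⟩, x, hxS, hx⟩
      refine hwf.induction (P := fun r => ∀ y ∈ S, (r, y) ∈ U → Acc (DependsOn U) (r, y)) htA
        (fun r hr ihr y hy hry => ⟨_, fun q hq => ?_⟩) x hxS hx
      obtain ⟨r', z⟩ := q
      obtain ⟨-, hlt, hqU, -, hz⟩ := hq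
      simp only at hlt hz
      have hmark : marks U m (j, y) = true := by
        simp only [marks, decide_eq_true_eq]
        exact ⟨r, hr.1, hry⟩
      have hzS : z ∈ S := by
        rcases hz with rfl | ⟨e, rfl⟩
        · exact hy
        · exact hSc y hy hmark e
      by_cases hr' : r' ≤ j / 2 ^ m
      · exact ih _ hr'
      · exact ihr r' ⟨⟨not_le.1 hr', hlt.le.trans hr.1.2⟩, z, hzS, hqU⟩ hlt z hzS hqU
  refine ⟨fun p => ?_⟩
  obtain ⟨n, hn⟩ := exists_nat_ge (p.1 * 2 ^ m)
  exact key n p ((le_div_iff₀ hpow).2 hn)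

lemma ae_nice {d : ℕ} {Ω : Type*} [MeasurableSpace Ω] {P : Measure Ω}
    {U : Ω → Set (ℝ × Site d)} (hU : IsPoissonPointProcess U (clockIntensity d) P) :
    ∀ᵐ ω ∂P, Nice (U ω) := by
  have h1 := ae_exists_no_openWalk (slotLaw (d + 1)) (slotLaw_subcritical d)
  rw [← map_marks hU] at h1
  have h2 := ae_of_ae_map (measurable_marks' hU _).aemeasurable h1
  filter_upwards [ae_finite_ringsUpTo hU, h2] with ω hω1 hω2
  refine ⟨hω1, wellFounded_dependsOn (m := d + 1) hω1 fun j x => ?_⟩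
  obtain ⟨n, hn⟩ := hω2 j x
  exact exists_finite_closed hn

/-! ### Moments of the continuous time minimum as limits of discrete moments. -/

lemma integrable_pow_poissonMeasure (r : NNReal) (j : ℕ) :
    Integrable (fun k : ℕ => (k : ℝ) ^ j) (poissonMeasure r) := by
  rw [integrable_poissonMeasure_iff]
  have h := (Real.summable_pow_div_factorial (r * 2 ^ j)).mul_left (Real.exp (-r))
  refine h.of_nonneg_of_le (fun k => by positivity) fun k => ?_
  have h1 : (k : ℝ) ^ j ≤ (2 ^ j) ^ k := by
    rw [← pow_mul, mul_comm j k, pow_mul]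
    exact pow_le_pow_left₀ (by positivity) (by exact_mod_cast Nat.lt_two_pow_self.le) j
  rw [Real.norm_of_nonneg (by positivity), mul_pow]
  calc Real.exp (-r) * r ^ k / k.factorial * (k : ℝ) ^ j
      ≤ Real.exp (-r) * r ^ k / k.factorial * (2 ^ j) ^ k :=
        mul_le_mul_of_nonneg_left h1 (by positivity)
    _ = _ := by ring

/-- The number of rings at the origin up to time `n`. -/
noncomputable def ringCount {d : ℕ} (U : Set (ℝ × Site d)) (n : ℕ) : ℕ :=
  (U ∩ Set.Ioc (0 : ℝ) n ×ˢ {0}).encard.toNat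

/-- The origin rises at most once per marked slot, and distinct marked slots contain distinct rings.
The bound does not involve `m`, so it serves for dominated convergence. -/
lemma minWell_marks_le_ringCount {d : ℕ} {U : Set (ℝ × Site d)} (hU : Nice U) (n m : ℕ) :
    (minWell (marks U m) (n * 2 ^ m) : ℝ) ≤ ringCount U n := by
  have hpow : (0 : ℝ) < 2 ^ m := by positivity
  have hfin : (U ∩ Set.Ioc (0 : ℝ) n ×ˢ {0}).Finite := by
    refine ((hU.finite_ringsUpTo 0 n).image fun r => (r, 0)).subset ?_
    rintro ⟨r, x⟩ ⟨h1, h2, h3⟩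
    obtain rfl : x = 0 := h3
    exact ⟨r, ⟨h2.1, h2.2, h1⟩, rfl⟩
  have h1 := minWell_le_sum (marks U m) (n * 2 ^ m)
  rw [Finset.sum_boole] at h1
  have h2 : (Finset.range (n * 2 ^ m)).filter (fun j => marks U m (j, 0) = true) ⊆
      hfin.toFinset.image fun p => ⌈p.1 * 2 ^ m⌉₊ - 1 := by
    intro j hj
    obtain ⟨hjn, r, hr, hrU⟩ : j < n * 2 ^ m ∧ ∃ r ∈ slot m j, (r, 0) ∈ U := by
      have hj' := Finset.mem_filter.1 hj
      exact ⟨Finset.mem_range.1 hj'.1, by simpa [marks] using hj'.2⟩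
    have h0 : (0 : ℝ) ≤ j / 2 ^ m := by positivity
    simp only [Finset.mem_image, Set.Finite.mem_toFinset]
    refine ⟨(r, 0), ⟨hrU, ⟨h0.trans_lt hr.1, hr.2.trans ?_⟩, rfl⟩, ?_⟩
    · rw [div_le_iff₀ hpow]
      exact_mod_cast hjn
    · have h3 : ⌈r * 2 ^ m⌉₊ = j + 1 := by
        rw [Nat.ceil_eq_iff (by omega)]
        have h4 := hr.1
        have h5 := hr.2
        rw [div_lt_iff₀ hpow] at h4
        rw [le_div_iff₀ hpow] at h5
        push_cast
        exact ⟨by simpa using h4, h5⟩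
      simp [h3]
  have h3 := (Finset.card_le_card h2).trans Finset.card_image_le
  have h4 : ringCount U n = hfin.toFinset.card := by
    rw [ringCount, hfin.encard_eq_coe_toFinset_card, ENat.toNat_natCast]
  rw [h4]
  exact_mod_cast h1.trans (by exact_mod_cast h3)

open Classical in
/-- The minimum height at time `n` of the dual RSOS surface driven by `U`. -/
noncomputable def heightAt {d : ℕ} (U : Set (ℝ × Site d)) (n : ℕ) : ℝ :=
  if h : Nice U then (minHeight (surface h l1Norm) n : ℝ) else 0

lemma heightAt_eq {d : ℕ} {U : Set (ℝ × Site d)} (hU : Nice U) {f : ℝ → Site d → ℤ}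
    (hf : IsDualRSOS U f) (n : ℕ) : heightAt U n = minHeight f n := by
  rw [heightAt, dif_pos hU, minHeight, minHeight, iInf_congr fun x =>
    IsRSOS.eq_of_nice (isRSOS_surface hU l1Norm) hf hU (Nat.cast_nonneg n) x]

lemma heightAt_nonneg {d : ℕ} (U : Set (ℝ × Site d)) (n : ℕ) : 0 ≤ heightAt U n := by
  unfold heightAt
  split_ifs with hU
  · exact_mod_cast minHeight_nonneg (isRSOS_surface hU l1Norm) hU (Nat.cast_nonneg n)
  · exact le_rfl

lemma eventually_minWell_eq_heightAt {d : ℕ} {U : Set (ℝ × Site d)} (hU : Nice U) (n : ℕ) :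
    ∀ᶠ m : ℕ in atTop, (minWell (marks U m) (n * 2 ^ m) : ℝ) = heightAt U n := by
  filter_upwards [eventually_minWell_eq (isRSOS_surface hU l1Norm) hU n] with m hm
  rw [hm, heightAt_eq hU (isRSOS_surface hU l1Norm)]

section Moments

variable {d : ℕ} {Ω : Type*} [MeasurableSpace Ω] {P : Measure Ω}
  {U : Ω → Set (ℝ × Site d)}

lemma integrable_ringCount_pow (hU : IsPoissonPointProcess U (clockIntensity d) P) (n j : ℕ) :
    Integrable (fun ω => (ringCount (U ω) n : ℝ) ^ j) P := by
  have hm := hU.measurable_count (Set.Ioc (0 : ℝ) n ×ˢ {0})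
    (measurableSet_Ioc.prod (measurableSet_singleton _))
  have hg : Measurable fun k : ℕ∞ => ((k.toNat : ℝ) ^ j) := measurable_of_countable _
  change Integrable ((fun k : ℕ∞ => ((k.toNat : ℝ) ^ j)) ∘ _) P
  rw [← integrable_map_measure hg.aestronglyMeasurable hm.aemeasurable,
    map_count_Ioc hU 0 le_rfl, integrable_map_measure hg.aestronglyMeasurable
      Measurable.of_discrete.aemeasurable]
  exact integrable_pow_poissonMeasure _ j

lemma aemeasurable_heightAt (hU : IsPoissonPointProcess U (clockIntensity d) P) (n : ℕ) :
    AEMeasurable (fun ω => heightAt (U ω) n) P := by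
  refine aemeasurable_of_tendsto_metrizable_ae atTop
    (f := fun m ω => (minWell (marks (U ω) m) (n * 2 ^ m) : ℝ))
    (fun m => ((measurable_minWell_real _).comp (measurable_marks' hU m)).aemeasurable) ?_
  filter_upwards [ae_nice hU] with ω hω
  exact tendsto_const_nhds.congr' ((eventually_minWell_eq_heightAt hω n).mono fun m hm => hm.symm)

lemma integrable_heightAt_pow (hU : IsPoissonPointProcess U (clockIntensity d) P) (n j : ℕ) :
    Integrable (fun ω => heightAt (U ω) n ^ j) P := by
  refine (integrable_ringCount_pow hU n j).mono'
    ((aemeasurable_heightAt hU n).pow_const j).aestronglyMeasurable ?_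
  filter_upwards [ae_nice hU] with ω hω
  obtain ⟨m, hm⟩ := (eventually_minWell_eq_heightAt hω n).exists
  rw [Real.norm_of_nonneg (pow_nonneg (heightAt_nonneg _ n) j)]
  refine pow_le_pow_left₀ (heightAt_nonneg _ n) ?_ j
  rw [← hm]
  exact minWell_marks_le_ringCount hω n m

lemma tendsto_integral_minWell_pow (hU : IsPoissonPointProcess U (clockIntensity d) P)
    (n j : ℕ) :
    Tendsto (fun m : ℕ => ∫ β, (minWell β (n * 2 ^ m) : ℝ) ^ j ∂marksLaw d (slotLaw m)) atTop
      (𝓝 (∫ ω, heightAt (U ω) n ^ j ∂P)) := by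
  have h1 : ∀ m, ∫ β, (minWell β (n * 2 ^ m) : ℝ) ^ j ∂marksLaw d (slotLaw m) =
      ∫ ω, (minWell (marks (U ω) m) (n * 2 ^ m) : ℝ) ^ j ∂P := by
    intro m
    rw [← map_marks hU m, integral_map (measurable_marks' hU m).aemeasurable
      ((measurable_minWell_real _).pow_const j).aestronglyMeasurable]
  simp only [h1]
  refine tendsto_integral_of_dominated_convergence (fun ω => (ringCount (U ω) n : ℝ) ^ j)
    (fun m => (((measurable_minWell_real _).comp
      (measurable_marks' hU m)).pow_const j).aestronglyMeasurable)
    (integrable_ringCount_pow hU n j) (fun m => ?_) ?_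
  · filter_upwards [ae_nice hU] with ω hω
    rw [Real.norm_of_nonneg (pow_nonneg (minWell_real_nonneg _ _) j)]
    exact pow_le_pow_left₀ (minWell_real_nonneg _ _) (minWell_marks_le_ringCount hω n m) j
  · filter_upwards [ae_nice hU] with ω hω
    exact tendsto_const_nhds.congr'
      ((eventually_minWell_eq_heightAt hω n).mono fun m hm => by simp only [hm])

/-- The expected minimum height at time `n`, as a limit of discrete time expectations. -/
noncomputable def meanHeight (d n : ℕ) : ℝ :=
  limUnder atTop fun m : ℕ => ∫ β, (minWell β (n * 2 ^ m) : ℝ) ∂marksLaw d (slotLaw m)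

lemma tendsto_integral_minWell (hU : IsPoissonPointProcess U (clockIntensity d) P) (n : ℕ) :
    Tendsto (fun m : ℕ => ∫ β, (minWell β (n * 2 ^ m) : ℝ) ∂marksLaw d (slotLaw m)) atTop
      (𝓝 (∫ ω, heightAt (U ω) n ∂P)) := by
  simpa using tendsto_integral_minWell_pow hU n 1

/-- The right side mentions no probability space: the mean, and later the speed, is the same for
every realisation of the Poisson process. -/
lemma integral_heightAt (hU : IsPoissonPointProcess U (clockIntensity d) P) (n : ℕ) :
    ∫ ω, heightAt (U ω) n ∂P = meanHeight d n :=
  (tendsto_integral_minWell hU n).limUnder_eq.symm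

lemma meanHeight_add_le (hU : IsPoissonPointProcess U (clockIntensity d) P) (n k : ℕ) :
    meanHeight d (n + k) ≤ meanHeight d n + meanHeight d k := by
  simp only [← integral_heightAt hU]
  refine le_of_tendsto_of_tendsto' (tendsto_integral_minWell hU (n + k))
    ((tendsto_integral_minWell hU n).add (tendsto_integral_minWell hU k)) fun m => ?_
  rw [add_mul]
  exact integral_minWell_add_le _ _ _

lemma integral_heightAt_sq_le (hU : IsPoissonPointProcess U (clockIntensity d) P) (n : ℕ) :
    ∫ ω, heightAt (U ω) (2 * n) ^ 2 ∂P ≤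
      2 * ∫ ω, heightAt (U ω) n ^ 2 ∂P + 2 * meanHeight d n ^ 2 := by
  rw [← integral_heightAt hU]
  refine le_of_tendsto_of_tendsto' (tendsto_integral_minWell_pow hU (2 * n) 2)
    (((tendsto_integral_minWell_pow hU n 2).const_mul 2).add
      (((tendsto_integral_minWell hU n).pow 2).const_mul 2)) fun m => ?_
  rw [two_mul, add_mul]
  exact integral_minWell_sq_le _ _

lemma exists_le_meanHeight (hd : 1 ≤ d) (hU : IsPoissonPointProcess U (clockIntensity d) P) :
    ∃ c : ℝ, 0 < c ∧ ∃ C : ℝ, ∀ n : ℕ, c * n - C ≤ meanHeight d n := by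
  obtain ⟨c, hc, C, h⟩ := exists_linear_lower_bound d hd
  refine ⟨c / 2, by positivity, C, fun n => ?_⟩
  rw [← integral_heightAt hU]
  refine ge_of_tendsto' (tendsto_integral_minWell hU n) fun m => ?_
  refine le_trans ?_ (h (slotLaw m) (n * 2 ^ m))
  have h1 := mul_le_mul_of_nonneg_right (le_slotLaw_real m)
    (by positivity : (0 : ℝ) ≤ (n * 2 ^ m : ℕ))
  have h2 : ((1 / 2 : ℝ) ^ m / 2) * (n * 2 ^ m : ℕ) = n / 2 := by
    push_cast
    rw [one_div, inv_pow]
    field_simp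
  rw [h2] at h1
  have := mul_le_mul_of_nonneg_left h1 hc.le
  linarith

end Moments

/-! ### From moments to almost sure limits and hitting times. -/

/-- Random variables whose second moments satisfy the doubling inequality of a subadditive process
converge almost surely to the limit of their means. -/
lemma ae_tendsto_of_doubling {Ω : Type*} [MeasurableSpace Ω] {P : Measure Ω}
    [IsProbabilityMeasure P] {Y : ℕ → Ω → ℝ} {γ : ℝ} (h1 : ∀ k, Integrable (Y k) P)
    (h2 : ∀ k, Integrable (fun ω => Y k ω ^ 2) P)
    (hdouble : ∀ k, ∫ ω, Y (k + 1) ω ^ 2 ∂P ≤ (∫ ω, Y k ω ^ 2 ∂P) / 2 + (∫ ω, Y k ω ∂P) ^ 2 / 2)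
    (hmean : Tendsto (fun k => ∫ ω, Y k ω ∂P) atTop (𝓝 γ)) :
    ∀ᵐ ω ∂P, Tendsto (fun k => Y k ω) atTop (𝓝 γ) := by
  set m : ℕ → ℝ := fun k => ∫ ω, Y k ω ∂P with hm
  set s : ℕ → ℝ := fun k => ∫ ω, Y k ω ^ 2 ∂P with hs
  have hint : ∀ k, Integrable (fun ω => (Y k ω - m k) ^ 2) P := by
    intro k
    have : (fun ω => (Y k ω - m k) ^ 2) = fun ω => Y k ω ^ 2 - 2 * m k * Y k ω + m k ^ 2 := by
      ext ω; ring
    rw [this]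
    exact ((h2 k).sub ((h1 k).const_mul _)).add (integrable_const _)
  have hv : ∀ k, ∫ ω, (Y k ω - m k) ^ 2 ∂P = s k - m k ^ 2 := by
    intro k
    have : (fun ω => (Y k ω - m k) ^ 2) = fun ω => Y k ω ^ 2 - 2 * m k * Y k ω + m k ^ 2 := by
      ext ω; ring
    rw [this, integral_add (f := fun ω => Y k ω ^ 2 - 2 * m k * Y k ω)
      ((h2 k).sub ((h1 k).const_mul _)) (integrable_const _),
      integral_sub (h2 k) ((h1 k).const_mul _), integral_const_mul]
    simp only [integral_const, probReal_univ, one_smul]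
    change s k - 2 * m k * m k + m k ^ 2 = _
    ring
  have hv0 : ∀ k, 0 ≤ s k - m k ^ 2 := fun k => by
    rw [← hv]; exact integral_nonneg fun ω => sq_nonneg _
  -- The doubling inequality says that the second moment drops at each step by at least half of the
  -- variance; telescoping makes the variances summable.
  have hsum : ∀ K, (∑ k ∈ Finset.range K, (s k - m k ^ 2)) / 2 + s K ≤ s 0 := by
    intro K
    induction K with
    | zero => simp
    | succ K ih =>
      rw [Finset.sum_range_succ]
      have := hdouble K
      change s (K + 1) ≤ s K / 2 + m K ^ 2 / 2 at this
      linarith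
  have hsummable : Summable fun k => s k - m k ^ 2 := by
    refine summable_of_sum_range_le (c := 2 * s 0) hv0 fun K => ?_
    have h3 : 0 ≤ s K := integral_nonneg fun ω => sq_nonneg _
    have := hsum K
    linarith
  have hfin : ∫⁻ ω, ∑' k, ENNReal.ofReal ((Y k ω - m k) ^ 2) ∂P ≠ ⊤ := by
    rw [lintegral_tsum fun k => (hint k).aemeasurable.ennreal_ofReal]
    have : ∀ k, ∫⁻ ω, ENNReal.ofReal ((Y k ω - m k) ^ 2) ∂P = ENNReal.ofReal (s k - m k ^ 2) := by
      intro k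
      rw [← hv, ofReal_integral_eq_lintegral_ofReal (hint k)
        (Filter.Eventually.of_forall fun ω => sq_nonneg _)]
    simp only [this]
    exact hsummable.tsum_ofReal_ne_top
  have hae := ae_lt_top' (AEMeasurable.tsum fun k =>
    (hint k).aemeasurable.ennreal_ofReal) hfin
  filter_upwards [hae] with ω hω
  have h3 := ENNReal.tendsto_atTop_zero_of_tsum_ne_top hω.ne
  have h4 : Tendsto (fun k => (Y k ω - m k) ^ 2) atTop (𝓝 0) := by
    have h5 := (ENNReal.tendsto_toReal ENNReal.zero_ne_top).comp h3
    refine h5.congr fun k => ?_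
    simp only [Function.comp]
    rw [ENNReal.toReal_ofReal (sq_nonneg _)]
  have h6 : Tendsto (fun k => Y k ω - m k) atTop (𝓝 0) := by
    rw [tendsto_zero_iff_abs_tendsto_zero]
    have h7 := h4.sqrt
    rw [Real.sqrt_zero] at h7
    refine h7.congr fun k => ?_
    exact Real.sqrt_sq_eq_abs _
  have h8 := h6.add hmean
  rw [zero_add] at h8
  exact h8.congr fun k => by simp [m]

/-- A monotone function whose slopes converge along all the sequences `2 ^ k * n` has converging
slopes. -/
lemma tendsto_div_of_monotoneOn {G : ℝ → ℝ} {γ : ℝ} (hγ : 0 < γ)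
    (hG : MonotoneOn G (Set.Ici 0))
    (h : ∀ n : ℕ, 0 < n → Tendsto (fun k : ℕ => G (2 ^ k * n) / (2 ^ k * n)) atTop (𝓝 γ)) :
    Tendsto (fun t => G t / t) atTop (𝓝 γ) := by
  rw [Metric.tendsto_atTop]
  intro ε hε
  set δ := min (ε / 4) γ with hδ
  have hδ0 : 0 < δ := lt_min (by positivity) hγ
  have hδ1 : δ ≤ ε / 4 := min_le_left _ _
  have hδ2 : δ ≤ γ := min_le_right _ _
  -- Write `t` between `2 ^ k * n` and `2 ^ k * (n + 1)` with `N ≤ n < 2 * N`. Then `2 ^ k ≤ t / N`,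
  -- so the rounding costs at most a small multiple of `ε * t`, and only finitely many `n` are
  -- involved.
  obtain ⟨N, hN⟩ := exists_nat_gt (max (8 * γ / ε) 1)
  have hN1 : (1 : ℝ) < N := (le_max_right _ _).trans_lt hN
  have hN2 : 8 * γ < ε * N := by
    have := (le_max_left _ _).trans_lt hN
    rw [div_lt_iff₀ hε] at this
    linarith
  have hN0 : 0 < N := by exact_mod_cast (by linarith : (0 : ℝ) < N)
  have hev : ∀ᶠ k : ℕ in atTop, ∀ n ∈ Set.Icc N (2 * N),
      |G (2 ^ k * n) / (2 ^ k * n) - γ| < δ := by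
    refine (Set.finite_Icc N (2 * N)).eventually_all.2 fun n hn => ?_
    have := (Metric.tendsto_nhds.1 (h n (hN0.trans_le hn.1))) δ hδ0
    simpa only [Real.dist_eq] using this
  obtain ⟨K, hK⟩ := eventually_atTop.1 hev
  refine ⟨2 ^ K * N, fun t ht => ?_⟩
  have hNr : (0 : ℝ) < N := by linarith
  have htpos : 0 < t := lt_of_lt_of_le (by positivity) ht
  have hx : 1 ≤ t / N := by
    rw [le_div_iff₀ hNr, one_mul]
    exact le_trans (le_mul_of_one_le_left hNr.le (one_le_pow₀ (by norm_num))) ht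
  obtain ⟨k, hk1, hk2⟩ := exists_nat_pow_near hx (by norm_num : (1 : ℝ) < 2)
  have hpow : (0 : ℝ) < 2 ^ k := by positivity
  rw [le_div_iff₀ hNr] at hk1
  rw [div_lt_iff₀ hNr] at hk2
  have hKk : K ≤ k := by
    by_contra hcon
    have : (2 : ℝ) ^ (k + 1) ≤ 2 ^ K := pow_le_pow_right₀ (by norm_num) (by omega)
    have := mul_le_mul_of_nonneg_right this hNr.le
    linarith
  set n := ⌊t / 2 ^ k⌋₊ with hn
  have hn1 : (n : ℝ) ≤ t / 2 ^ k := Nat.floor_le (by positivity)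
  have hn2 : t / 2 ^ k < n + 1 := Nat.lt_floor_add_one _
  have hnN : N ≤ n := Nat.le_floor (by rw [le_div_iff₀ hpow]; linarith)
  have hn2N : n + 1 ≤ 2 * N := by
    have h3 : (n : ℝ) < 2 * N := by
      refine hn1.trans_lt ?_
      rw [div_lt_iff₀ hpow]
      rw [pow_succ] at hk2
      linarith
    have h4 : n < 2 * N := by exact_mod_cast h3
    omega
  rw [le_div_iff₀ hpow] at hn1
  rw [div_lt_iff₀ hpow] at hn2
  have hnr : (N : ℝ) ≤ n := by exact_mod_cast hnN
  have e1 := hK k hKk n ⟨hnN, by omega⟩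
  have e2 := hK k hKk (n + 1) ⟨by omega, hn2N⟩
  rw [abs_lt] at e1 e2
  have p1 : 0 < 2 ^ k * (n : ℝ) := mul_pos hpow (by linarith)
  have p2 : 0 < 2 ^ k * ((n + 1 : ℕ) : ℝ) := mul_pos hpow (by positivity)
  have l1 : (γ - δ) * (2 ^ k * n) ≤ G (2 ^ k * n) := by
    rw [← le_div_iff₀ p1]; linarith
  have l2 : G (2 ^ k * (n + 1 : ℕ)) ≤ (γ + δ) * (2 ^ k * (n + 1 : ℕ)) := by
    rw [← div_le_iff₀ p2]; linarith
  have g1 : G (2 ^ k * n) ≤ G t :=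
    hG (Set.mem_Ici.2 p1.le) (Set.mem_Ici.2 htpos.le) (by linarith)
  have g2 : G t ≤ G (2 ^ k * (n + 1 : ℕ)) :=
    hG (Set.mem_Ici.2 htpos.le) (Set.mem_Ici.2 p2.le) (by push_cast; linarith)
  have hkt : 2 ^ k * γ * 8 < ε * t := by
    have : 2 ^ k * (8 * γ) < 2 ^ k * (ε * N) := mul_lt_mul_of_pos_left hN2 hpow
    have : ε * (2 ^ k * N) ≤ ε * t := mul_le_mul_of_nonneg_left hk1 hε.le
    linarith
  have hδk : 2 ^ k * δ ≤ 2 ^ k * γ := mul_le_mul_of_nonneg_left hδ2 hpow.le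
  have hδt : δ * t ≤ ε / 4 * t := mul_le_mul_of_nonneg_right hδ1 htpos.le
  push_cast at l2
  have u1 : (γ + δ) * (2 ^ k * (n + 1)) ≤ (γ + δ) * (t + 2 ^ k) :=
    mul_le_mul_of_nonneg_left (by linarith) (by linarith)
  have u2 : (γ - δ) * (t - 2 ^ k) ≤ (γ - δ) * (2 ^ k * n) :=
    mul_le_mul_of_nonneg_left (by linarith) (by linarith)
  rw [Real.dist_eq, abs_lt]
  constructor
  · rw [neg_lt_sub_iff_lt_add, ← sub_lt_iff_lt_add', lt_div_iff₀ htpos]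
    nlinarith
  · rw [sub_lt_iff_lt_add, div_lt_iff₀ htpos]
    push_cast at g2
    nlinarith

lemma tendsto_hitTime_div {d : ℕ} {f : ℝ → Site d → ℤ} {γ : ℝ} (hγ : 0 < γ)
    (hf : MonotoneOn (fun t => (minHeight f t : ℝ)) (Set.Ici 0))
    (h : Tendsto (fun t => (minHeight f t : ℝ) / t) atTop (𝓝 γ)) :
    (∀ u, (hittingSet f u).Nonempty) ∧
      Tendsto (fun u : ℕ => hitTime f u / (u : ℝ)) atTop (𝓝 γ⁻¹) := by
  have lower : ∀ c, 0 < c → c < γ → ∃ t0 : ℝ, 0 < t0 ∧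
      ∀ t, t0 ≤ t → c * t ≤ (minHeight f t : ℝ) := by
    intro c hc hcγ
    obtain ⟨t0, ht0⟩ := eventually_atTop.1 (h.eventually_const_lt hcγ)
    refine ⟨max t0 1, by positivity, fun t ht => ?_⟩
    have htpos : 0 < t := lt_of_lt_of_le (by positivity) ht
    rw [← le_div_iff₀ htpos]
    exact (ht0 t ((le_max_left _ _).trans ht)).le
  have hmem : ∀ c, 0 < c → c < γ → ∃ t0 : ℝ, ∀ u : ℕ, t0 ≤ u / c → (u : ℝ) / c ∈ hittingSet f u := by
    intro c hc hcγ
    obtain ⟨t0, ht0, h0⟩ := lower c hc hcγ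
    refine ⟨t0, fun u hu => ⟨by positivity, ?_⟩⟩
    have := h0 _ hu
    rw [mul_div_cancel₀ _ hc.ne'] at this
    exact_mod_cast this
  have hne : ∀ u, (hittingSet f u).Nonempty := by
    intro u
    obtain ⟨t0, ht0, h0⟩ := lower (γ / 2) (by positivity) (by linarith)
    refine ⟨max t0 (u / (γ / 2)), by positivity, ?_⟩
    have h1 := h0 _ (le_max_left t0 (u / (γ / 2)))
    have h2 : (u : ℝ) ≤ γ / 2 * max t0 (u / (γ / 2)) := by
      rw [← div_le_iff₀' (by positivity)]
      exact le_max_right _ _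
    exact_mod_cast h2.trans h1
  have hbdd : ∀ u, BddBelow (hittingSet f u) := fun u => ⟨0, fun t ht => ht.1⟩
  refine ⟨hne, tendsto_order.2 ⟨fun a ha => ?_, fun b hb => ?_⟩⟩
  · obtain ⟨c, hc1, hc2⟩ : ∃ c, γ < c ∧ a < c⁻¹ := by
      rcases le_or_gt a 0 with ha0 | ha0
      · exact ⟨γ + 1, by linarith, ha0.trans_lt (by positivity)⟩
      · obtain ⟨c, hc1, hc2⟩ := exists_between ((lt_inv_comm₀ ha0 hγ).1 ha)
        exact ⟨c, hc1, (lt_inv_comm₀ ha0 (hγ.trans hc1)).2 hc2⟩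
    have hc0 : 0 < c := hγ.trans hc1
    obtain ⟨t1, ht1⟩ := eventually_atTop.1 (h.eventually_lt_const hc1)
    set t2 := max t1 1
    have ht2 : 0 < t2 := by positivity
    -- Levels above the height reached at `t2` are hit only after `t2`, where the bound `minHeight f
    -- t < c * t` is available.
    obtain ⟨u0, hu0⟩ := exists_nat_gt (max (minHeight f t2 : ℝ) 0)
    filter_upwards [eventually_ge_atTop u0] with u hu
    have hu' : (u0 : ℝ) ≤ u := by exact_mod_cast hu
    have hupos : (0 : ℝ) < u := ((le_max_right _ _).trans_lt hu0).trans_le hu'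
    rw [lt_div_iff₀ hupos]
    refine lt_of_lt_of_le (mul_lt_mul_of_pos_right hc2 hupos) (le_csInf (hne u) fun t ht => ?_)
    have hut : (u : ℝ) ≤ minHeight f t := by exact_mod_cast ht.2
    have ht2t : t2 < t := by
      by_contra hcon
      have h3 : (minHeight f t : ℝ) ≤ minHeight f t2 :=
        hf (Set.mem_Ici.2 ht.1) (Set.mem_Ici.2 ht2.le) (not_lt.1 hcon)
      have := (le_max_left _ _).trans_lt hu0
      linarith
    have h4 := ht1 t ((le_max_left _ _).trans ht2t.le)
    rw [div_lt_iff₀ (ht2.trans ht2t)] at h4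
    rw [inv_mul_le_iff₀ hc0]
    linarith
  · obtain ⟨c, hc1, hc2⟩ := exists_between (inv_lt_of_inv_lt₀ hγ hb)
    have hb0 : 0 < b := (inv_pos.2 hγ).trans hb
    have hc0 : 0 < c := (inv_pos.2 hb0).trans hc1
    obtain ⟨t0, ht0⟩ := hmem c hc0 hc2
    have hev : ∀ᶠ u : ℕ in atTop, t0 ≤ u / c :=
      (tendsto_natCast_atTop_atTop.atTop_div_const hc0).eventually_ge_atTop t0
    filter_upwards [hev, eventually_gt_atTop 0] with u hu hu0
    have hupos : (0 : ℝ) < u := by exact_mod_cast hu0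
    rw [div_lt_iff₀ hupos]
    refine (csInf_le (hbdd u) (ht0 u hu)).trans_lt ?_
    rw [div_lt_iff₀ hc0]
    have h5 : 1 < b * c := by
      rw [inv_lt_iff_one_lt_mul₀ hb0] at hc1
      linarith
    nlinarith

/-! ### The speed: existence, positivity, almost sure convergence along doubling times. -/

/-- The speed of the dual RSOS surface. -/
noncomputable def speed (d : ℕ) : ℝ := limUnder atTop fun n : ℕ => meanHeight d n / n

section Speed

variable {d : ℕ} {Ω : Type*} [MeasurableSpace Ω] {P : Measure Ω} {U : Ω → Set (ℝ × Site d)}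

lemma meanHeight_nonneg (hU : IsPoissonPointProcess U (clockIntensity d) P) (n : ℕ) :
    0 ≤ meanHeight d n := by
  rw [← integral_heightAt hU]
  exact integral_nonneg fun ω => heightAt_nonneg _ n

lemma tendsto_meanHeight_div (hU : IsPoissonPointProcess U (clockIntensity d) P) :
    Tendsto (fun n : ℕ => meanHeight d n / n) atTop (𝓝 (speed d)) := by
  have hsub : Subadditive (meanHeight d) := meanHeight_add_le hU
  refine tendsto_nhds_limUnder ⟨_, hsub.tendsto_lim ⟨0, ?_⟩⟩
  rintro _ ⟨n, rfl⟩
  exact div_nonneg (meanHeight_nonneg hU n) (Nat.cast_nonneg n)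

lemma speed_pos (hd : 1 ≤ d) (hU : IsPoissonPointProcess U (clockIntensity d) P) :
    0 < speed d := by
  obtain ⟨c, hc, C, h⟩ := exists_le_meanHeight hd hU
  refine hc.trans_le (le_of_tendsto_of_tendsto (f := fun n : ℕ => c - C / n) ?_
    (tendsto_meanHeight_div hU) ?_)
  · simpa using tendsto_const_nhds.sub (tendsto_const_div_atTop_nhds_zero_nat C)
  · filter_upwards [eventually_gt_atTop 0] with n hn
    have hn' : (0 : ℝ) < n := by exact_mod_cast hn
    rw [le_div_iff₀ hn', sub_mul, div_mul_cancel₀ _ hn'.ne']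
    exact h n

lemma ae_tendsto_heightAt [IsProbabilityMeasure P]
    (hU : IsPoissonPointProcess U (clockIntensity d) P) {n : ℕ} (hn : 0 < n) :
    ∀ᵐ ω ∂P, Tendsto (fun k : ℕ => heightAt (U ω) (2 ^ k * n) / ((2 ^ k * n : ℕ) : ℝ)) atTop
      (𝓝 (speed d)) := by
  have hpos : ∀ k : ℕ, (0 : ℝ) < (2 ^ k * n : ℕ) := fun k => by positivity
  have hm : ∀ k : ℕ, ∫ ω, heightAt (U ω) (2 ^ k * n) / ((2 ^ k * n : ℕ) : ℝ) ∂P =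
      meanHeight d (2 ^ k * n) / ((2 ^ k * n : ℕ) : ℝ) := fun k => by
    rw [integral_div, integral_heightAt hU]
  refine ae_tendsto_of_doubling (fun k => ?_) (fun k => ?_) (fun k => ?_) ?_
  · simpa using (integrable_heightAt_pow hU (2 ^ k * n) 1).div_const ((2 ^ k * n : ℕ) : ℝ)
  · simp only [div_pow]
    exact (integrable_heightAt_pow hU (2 ^ k * n) 2).div_const _
  · rw [hm]
    simp only [div_pow, integral_div]
    have h1 := integral_heightAt_sq_le hU (2 ^ k * n)
    rw [← mul_assoc, ← pow_succ'] at h1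
    -- Doubling the time multiplies the squared normalisation by four, which turns the factors `2`
    -- of the moment inequality into `1 / 2`.
    have h2 : (((2 ^ (k + 1) * n : ℕ) : ℝ)) ^ 2 = 4 * ((2 ^ k * n : ℕ) : ℝ) ^ 2 := by
      push_cast; ring
    have h3 : 0 < ((2 ^ k * n : ℕ) : ℝ) ^ 2 := by have := hpos k; positivity
    rw [h2, div_le_iff₀ (by positivity)]
    refine h1.trans (le_of_eq ?_)
    field_simp
    ring
  · simp only [hm]
    refine (tendsto_meanHeight_div hU).comp (tendsto_atTop_mono (f := fun k : ℕ => k) (fun k => ?_)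
      tendsto_id)
    exact Nat.lt_two_pow_self.le.trans (Nat.le_mul_of_pos_right _ hn)

end Speed

end DualRSOS

open DualRSOS in
theorem mainTheorem5 (d : ℕ) (hd : 1 ≤ d) :
    ∃ ρ : ℝ, 0 < ρ ∧
      ∀ (Ω : Type*) [MeasurableSpace Ω] (P : Measure Ω) [IsProbabilityMeasure P]
        (U : Ω → Set (ℝ × Site d)),
        IsPoissonPointProcess U (clockIntensity d) P →
        ∀ᵐ ω ∂P, ∃ f : ℝ → Site d → ℤ,
          IsDualRSOS (U ω) f ∧
          (∀ g : ℝ → Site d → ℤ, IsDualRSOS (U ω) g → ∀ t, 0 ≤ t → ∀ x, g t x = f t x) ∧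
          (∀ u : ℕ, (hittingSet f u).Nonempty) ∧
          Tendsto (fun u : ℕ => hitTime f u / (u : ℝ)) atTop (𝓝 ρ) ∧
          Tendsto (fun t : ℝ => (minHeight f t : ℝ) / t) atTop (𝓝 ρ⁻¹) := by
  refine ⟨if 0 < speed d then (speed d)⁻¹ else 1, ?_, fun Ω _ P _ U hU => ?_⟩
  · split_ifs with h
    exacts [inv_pos.2 h, one_pos]
  have hpos := speed_pos hd hU
  rw [if_pos hpos, inv_inv]
  have hlim : ∀ᵐ ω ∂P, ∀ n : ℕ, 0 < n → Tendsto (fun k : ℕ =>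
      heightAt (U ω) (2 ^ k * n) / ((2 ^ k * n : ℕ) : ℝ)) atTop (𝓝 (speed d)) :=
    ae_all_iff.2 fun n => by
      by_cases hn : 0 < n
      · filter_upwards [ae_tendsto_heightAt hU hn] with ω hω _ using hω
      · exact Filter.Eventually.of_forall fun ω h => absurd h hn
  filter_upwards [ae_nice hU, hlim] with ω hω hωlim
  set f := surface hω l1Norm with hf
  have hfd : IsDualRSOS (U ω) f := isRSOS_surface hω l1Norm
  have hmono : MonotoneOn (fun t => (minHeight f t : ℝ)) (Set.Ici 0) := fun s hs t _ hst =>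
    Int.cast_le.2 (minHeight_mono hfd hω hs hst)
  have htend : Tendsto (fun t : ℝ => (minHeight f t : ℝ) / t) atTop (𝓝 (speed d)) := by
    refine tendsto_div_of_monotoneOn hpos hmono fun n hn => (hωlim n hn).congr fun k => ?_
    rw [heightAt_eq hω hfd]
    push_cast
    rfl
  obtain ⟨h1, h2⟩ := tendsto_hitTime_div hpos hmono htend
  exact ⟨f, hfd, fun g hg t ht x => IsRSOS.eq_of_nice hg hfd hω ht x, h1, h2, htend⟩
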